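/- Let $(\Omega,\Sigma,\mu)$ be a complete $\sigma$-finite measure space, let $\mathbb{K}$ be $\mathbb{R}$ or $\mathbb{C}$, and let $L_0$ be the space of classes (modulo equality a.e.) of measurable functions $\Omega\to\mathbb{K}$ that are integrable over every set of finite measure. A Köthe space over $\mu$ is a Banach space $X$ that is a linear subspace of $L_0$, contains $\chi_\sigma$ for every $\sigma\in\Sigma$ with $\mu(\sigma)<\infty$, and satisfies: if $g\in X$, $f$ is measurable and $|f|\le|g|$ a.e., then $f\in X$ and $\|f\|_X\le\|g\|_X$. It has the Fatou property if its closed unit ball is closed in $L_0$ for convergence in measure on sets of finite measure. Let $X$ and $Y$ be Köthe spaces over $\mu$ with the Fatou property. Let $M(X,Y)=\{\lambda\in L_0:\lambda f\in Y\text{ for all }f\in X\}$, normed by the operator norm of $M_\lambda\colon X\to Y$, $M_\lambda f=\lambda f$, which is a bounded operator. For $Z=Y$ or $Z=M(X,Y)$, let $Z_o$ be the set of order continuous elements of $Z$, i.e. those $f\in Z$ such that $\|f_n\|_Z\to0$ for every sequence $(f_n)$ in $Z$ with $0\le f_n\le|f|$ and $f_n\downarrow0$ a.e.; $Z$ is order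 continuous if $Z=Z_o$. Let $\mathscr{L}(X,Y)$, $\mathscr{K}(X,Y)$, $\mathscr{W}(X,Y)$ be the bounded, compact and weakly compact linear operators from $X$ to $Y$, and let $\lambda\in M(X,Y)$. (i) Suppose $\mu$ is purely atomic, and that either $X$ is reflexive or $Y$ is order continuous. Then $$\operatorname{dist}_{\mathscr{L}(X,Y)}(M_\lambda,\mathscr{K}(X,Y))=\operatorname{dist}_{M(X,Y)}(\lambda,M(X,Y)_o).$$ (ii) Suppose $\mu$ is non-atomic, that $Y$ is $1$-disjointly homogeneous ($1$-DH), i.e. every sequence of pairwise disjointly supported norm-one elements of $Y$ has a subsequence equivalent to the unit vector basis of $\ell_1$, and that every simple function $f$ (finite linear combination of characteristic functions of sets of finite measure) belonging to $M(X,Y)$ has an absolutely continuous norm there, i.e. $\|f\chi_{\sigma_n}\|_{M(X,Y)}\to0$ for every decreasing sequence $(\sigma_n)$ in $\Sigma$ with $\mu(\bigcap_n\sigma_n)=0$. Then $$\operatorname{dist}_{\mathscr{L}(X,Y)}(M_\lambda,\mathscr{W}(X,Y))=\operatorname{dist}_{M(X,Y)}(\lambda,M(X,Y)_o).$$ -/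

import Mathlib

open MeasureTheory Filter Topology

/-- `A` is an atom: a measurable set of positive measure that cannot be split. -/
def IsAtomSet {Ω : Type*} [MeasurableSpace Ω] (μ : Measure Ω) (A : Set Ω) : Prop :=
  MeasurableSet A ∧ 0 < μ A ∧ ∀ B ⊆ A, MeasurableSet B → μ B = 0 ∨ μ (A \ B) = 0

/-- Purely atomic measure: every measurable set of positive measure contains an atom. -/
def IsPurelyAtomic {Ω : Type*} [MeasurableSpace Ω] (μ : Measure Ω) : Prop :=
  ∀ S : Set Ω, MeasurableSet S → 0 < μ S → ∃ A ⊆ S, IsAtomSet μ A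

/-- Non-atomic measure: there are no atoms. -/
def IsNonAtomic {Ω : Type*} [MeasurableSpace Ω] (μ : Measure Ω) : Prop :=
  ∀ A : Set Ω, ¬ IsAtomSet μ A

/-- `L₀(μ)`: classes, modulo equality almost everywhere, of measurable `𝕜`-valued functions
that are integrable over every measurable set of finite measure. -/
def LZero (𝕜 : Type*) [RCLike 𝕜] {Ω : Type*} [MeasurableSpace Ω] (μ : Measure Ω) :
    Submodule 𝕜 (Ω →ₘ[μ] 𝕜) where
  carrier := {f | ∀ s : Set Ω, MeasurableSet s → μ s < ⊤ → IntegrableOn f s μ}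
  zero_mem' := fun s _ _ =>
    (integrable_zero Ω 𝕜 (μ.restrict s)).congr (ae_restrict_of_ae (AEEqFun.coeFn_zero (β := 𝕜)).symm)
  add_mem' := fun {f g} hf hg s hs hμ =>
    ((hf s hs hμ).add (hg s hs hμ)).congr (ae_restrict_of_ae (AEEqFun.coeFn_add f g).symm)
  smul_mem' := fun c f hf s hs hμ =>
    ((hf s hs hμ).smul c).congr (ae_restrict_of_ae (AEEqFun.coeFn_smul c f).symm)

/-- The class of the characteristic function of a measurable set. -/
noncomputable def charFun (𝕜 : Type*) [RCLike 𝕜] {Ω : Type*} [MeasurableSpace Ω] (μ : Measure Ω)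
    (s : Set Ω) (hs : MeasurableSet s) : Ω →ₘ[μ] 𝕜 :=
  AEEqFun.mk (s.indicator fun _ => (1 : 𝕜)) (aestronglyMeasurable_const.indicator hs)

/-- A normed ideal space: a linear subspace of `L₀(μ)` with a norm such that `|f| ≤ |g|` a.e.,
`f` measurable and `g` in the space imply that `f` is in the space and `‖f‖ ≤ ‖g‖`. -/
structure IdealSpace (𝕜 : Type*) [RCLike 𝕜] {Ω : Type*} [MeasurableSpace Ω]
    (μ : Measure Ω) where
  toSubmodule : Submodule 𝕜 (Ω →ₘ[μ] 𝕜)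
  le_LZero : toSubmodule ≤ LZero 𝕜 μ
  nrm : toSubmodule → ℝ
  nrm_add_le : ∀ f g, nrm (f + g) ≤ nrm f + nrm g
  nrm_smul : ∀ (c : 𝕜) f, nrm (c • f) = ‖c‖ * nrm f
  eq_zero_of_nrm : ∀ f, nrm f = 0 → f = 0
  ideal : ∀ (f : Ω →ₘ[μ] 𝕜) (g : toSubmodule),
    (∀ᵐ ω ∂μ, ‖f ω‖ ≤ ‖(g : Ω →ₘ[μ] 𝕜) ω‖) → ∃ hf : f ∈ toSubmodule, nrm ⟨f, hf⟩ ≤ nrm g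

namespace IdealSpace

variable {𝕜 : Type*} [RCLike 𝕜] {Ω : Type*} [MeasurableSpace Ω] {μ : Measure Ω}

instance : CoeSort (IdealSpace 𝕜 μ) (Type _) := ⟨fun X => X.toSubmodule⟩

noncomputable instance (X : IdealSpace 𝕜 μ) : Norm X := ⟨X.nrm⟩

theorem normCore (X : IdealSpace 𝕜 μ) : NormedSpace.Core 𝕜 X where
  norm_nonneg f := by
    change 0 ≤ X.nrm f
    have h0 : X.nrm 0 = 0 := by simpa using X.nrm_smul 0 0
    have h1 : X.nrm (-f) = X.nrm f := by
      have := X.nrm_smul (-1) f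
      have hn : (-1 : 𝕜) • f = -f := neg_one_smul 𝕜 f
      rwa [hn, norm_neg, norm_one, one_mul] at this
    have h2 := X.nrm_add_le f (-f)
    have h3 : f + -f = 0 := add_neg_cancel f
    rw [h3, h0, h1] at h2
    linarith
  norm_smul c f := X.nrm_smul c f
  norm_triangle f g := X.nrm_add_le f g
  norm_eq_zero_iff f := by
    refine ⟨X.eq_zero_of_nrm f, ?_⟩
    rintro rfl
    change X.nrm 0 = 0
    simpa using X.nrm_smul 0 0

noncomputable instance (X : IdealSpace 𝕜 μ) : NormedAddCommGroup X :=
  NormedAddCommGroup.ofCore X.normCore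

noncomputable instance (X : IdealSpace 𝕜 μ) : NormedSpace 𝕜 X := NormedSpace.ofCore X.normCore

/-- `f` is order continuous: if `0 ≤ gₙ ≤ |f|` and `gₙ ↓ 0` pointwise then `‖gₙ‖ → 0`. The
equality `(‖g n ω‖ : 𝕜) = g n ω` says that `g n ω` is a non-negative real number. -/
def IsOrderContinuousElem (X : IdealSpace 𝕜 μ) (f : X) : Prop :=
  ∀ g : ℕ → X,
    (∀ᵐ ω ∂μ, (∀ n, ((‖(g n : Ω →ₘ[μ] 𝕜) ω‖ : ℝ) : 𝕜) = (g n : Ω →ₘ[μ] 𝕜) ω ∧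
        ‖(g n : Ω →ₘ[μ] 𝕜) ω‖ ≤ ‖(f : Ω →ₘ[μ] 𝕜) ω‖) ∧
      Antitone (fun n => ‖(g n : Ω →ₘ[μ] 𝕜) ω‖) ∧
      Tendsto (fun n => ‖(g n : Ω →ₘ[μ] 𝕜) ω‖) atTop (𝓝 0)) →
    Tendsto (fun n => ‖g n‖) atTop (𝓝 0)

/-- The ideal `X_o` of all order continuous elements of `X`. -/
def ocPart (X : IdealSpace 𝕜 μ) : Set X := {f | X.IsOrderContinuousElem f}

/-- `X` is order continuous: `X = X_o`. -/
def IsOrderContinuous (X : IdealSpace 𝕜 μ) : Prop := X.ocPart = Set.univ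

/-- `f` has an absolutely continuous norm: `‖f χ_{σₙ}‖ → 0` for every decreasing sequence of
measurable sets `σₙ` whose intersection is null. -/
def HasAbsContNorm (X : IdealSpace 𝕜 μ) (f : X) : Prop :=
  ∀ σ : ℕ → Set Ω, (∀ n, MeasurableSet (σ n)) → Antitone σ → μ (⋂ n, σ n) = 0 →
    ∀ g : ℕ → X, (∀ n, (g n : Ω →ₘ[μ] 𝕜) =ᵐ[μ] (σ n).indicator (f : Ω →ₘ[μ] 𝕜)) →
      Tendsto (fun n => ‖g n‖) atTop (𝓝 0)

/-- The element `|f|` of `X`. -/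
noncomputable def abs (X : IdealSpace 𝕜 μ) (f : X) : X :=
  ⟨AEEqFun.comp (fun z : 𝕜 => ((‖z‖ : ℝ) : 𝕜)) (by fun_prop) (f : Ω →ₘ[μ] 𝕜),
    (X.ideal _ f (by
      filter_upwards [AEEqFun.coeFn_comp (fun z : 𝕜 => ((‖z‖ : ℝ) : 𝕜)) (by fun_prop)
        (f : Ω →ₘ[μ] 𝕜)] with ω h
      simp [h])).1⟩

theorem coeFn_abs (X : IdealSpace 𝕜 μ) (f : X) :
    ∀ᵐ ω ∂μ, (X.abs f : Ω →ₘ[μ] 𝕜) ω = ((‖(f : Ω →ₘ[μ] 𝕜) ω‖ : ℝ) : 𝕜) := by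
  filter_upwards [AEEqFun.coeFn_comp (fun z : 𝕜 => ((‖z‖ : ℝ) : 𝕜)) (by fun_prop)
    (f : Ω →ₘ[μ] 𝕜)] with ω h
  exact h

theorem coeFn_sub' (X : IdealSpace 𝕜 μ) (f g : X) :
    ∀ᵐ ω ∂μ, ((f - g : X) : Ω →ₘ[μ] 𝕜) ω = (f : Ω →ₘ[μ] 𝕜) ω - (g : Ω →ₘ[μ] 𝕜) ω :=
  AEEqFun.coeFn_sub (f : Ω →ₘ[μ] 𝕜) g

theorem coeFn_add' (X : IdealSpace 𝕜 μ) (f g : X) :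
    ∀ᵐ ω ∂μ, ((f + g : X) : Ω →ₘ[μ] 𝕜) ω = (f : Ω →ₘ[μ] 𝕜) ω + (g : Ω →ₘ[μ] 𝕜) ω :=
  AEEqFun.coeFn_add (f : Ω →ₘ[μ] 𝕜) g

theorem coeFn_smul' (X : IdealSpace 𝕜 μ) (c : 𝕜) (f : X) :
    ∀ᵐ ω ∂μ, ((c • f : X) : Ω →ₘ[μ] 𝕜) ω = c * (f : Ω →ₘ[μ] 𝕜) ω :=
  AEEqFun.coeFn_smul c (f : Ω →ₘ[μ] 𝕜)

theorem norm_le_of_ae_le (X : IdealSpace 𝕜 μ) (f g : X)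
    (h : ∀ᵐ ω ∂μ, ‖(f : Ω →ₘ[μ] 𝕜) ω‖ ≤ ‖(g : Ω →ₘ[μ] 𝕜) ω‖) : ‖f‖ ≤ ‖g‖ :=
  (X.ideal f g h).2

theorem norm_abs (X : IdealSpace 𝕜 μ) (f : X) : ‖X.abs f‖ = ‖f‖ := by
  apply le_antisymm <;> apply X.norm_le_of_ae_le <;>
    filter_upwards [X.coeFn_abs f] with ω h <;> simp [h]

theorem continuous_abs (X : IdealSpace 𝕜 μ) : Continuous X.abs := by
  refine (LipschitzWith.of_dist_le' (K := 1) fun f g => ?_).continuous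
  rw [dist_eq_norm, dist_eq_norm, one_mul]
  apply X.norm_le_of_ae_le
  filter_upwards [X.coeFn_abs f, X.coeFn_abs g, X.coeFn_sub' f g,
    X.coeFn_sub' (X.abs f) (X.abs g)] with ω h1 h2 h3 h4
  rw [h4, h3, h1, h2, ← RCLike.ofReal_sub, RCLike.norm_ofReal]
  exact abs_norm_sub_norm_le _ _

theorem abs_abs (X : IdealSpace 𝕜 μ) (f : X) : X.abs (X.abs f) = X.abs f := by
  apply Subtype.ext
  apply AEEqFun.ext
  filter_upwards [X.coeFn_abs f, X.coeFn_abs (X.abs f)] with ω h1 h2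
  rw [h2, h1]; simp

theorem abs_add_of_abs (X : IdealSpace 𝕜 μ) (f g : X) (hf : X.abs f = f) (hg : X.abs g = g) :
    X.abs (f + g) = f + g := by
  apply Subtype.ext
  apply AEEqFun.ext
  filter_upwards [X.coeFn_abs f, X.coeFn_abs g, X.coeFn_add' f g, X.coeFn_abs (f + g)]
    with ω h1 h2 h3 h4
  rw [hf] at h1; rw [hg] at h2
  rw [h4, h3, h1, h2, ← RCLike.ofReal_add, RCLike.norm_ofReal,
    abs_of_nonneg (by positivity)]

theorem abs_sum_of_abs (X : IdealSpace 𝕜 μ) (u : ℕ → X) (hu : ∀ n, X.abs (u n) = u n)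
    (s : Finset ℕ) : X.abs (∑ n ∈ s, u n) = ∑ n ∈ s, u n := by
  induction s using Finset.induction_on with
  | empty =>
    rw [Finset.sum_empty, ← norm_eq_zero, norm_abs, norm_zero]
  | insert a s ha ih =>
    rw [Finset.sum_insert ha]
    exact X.abs_add_of_abs _ _ (hu a) ih

end IdealSpace

/-- A Köthe space over `μ`: a complete normed ideal space that contains the characteristic
functions of all measurable sets of finite measure. -/
structure KotheSpace (𝕜 : Type*) [RCLike 𝕜] {Ω : Type*} [MeasurableSpace Ω]
    (μ : Measure Ω) extends IdealSpace 𝕜 μ where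
  complete : ∀ u : ℕ → toSubmodule,
    (∀ ε : ℝ, 0 < ε → ∃ N, ∀ m ≥ N, ∀ n ≥ N, nrm (u m - u n) < ε) →
    ∃ f : toSubmodule, Tendsto (fun n => nrm (u n - f)) atTop (𝓝 0)
  char_mem : ∀ (s : Set Ω) (hs : MeasurableSet s), μ s < ⊤ → charFun 𝕜 μ s hs ∈ toSubmodule

namespace KotheSpace

variable {𝕜 : Type*} [RCLike 𝕜] {Ω : Type*} [MeasurableSpace Ω] {μ : Measure Ω}

instance : CoeSort (KotheSpace 𝕜 μ) (Type _) := ⟨fun X => X.toIdealSpace⟩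

instance (X : KotheSpace 𝕜 μ) : CompleteSpace X := by
  refine Metric.complete_of_cauchySeq_tendsto fun u hu => ?_
  obtain ⟨f, hf⟩ := X.complete u (by
    intro ε hε
    obtain ⟨N, hN⟩ := Metric.cauchySeq_iff.1 hu ε hε
    exact ⟨N, fun m hm n hn => by
      have := hN m hm n hn
      rw [dist_eq_norm] at this
      exact this⟩)
  exact ⟨f, tendsto_iff_norm_sub_tendsto_zero.2 hf⟩

/-- The Fatou property: the closed unit ball of `X` is closed in `L₀(μ)` for the (metrizable,
as `μ` is assumed σ-finite) topology of convergence in measure on sets of finite measure. -/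
def HasFatou (X : KotheSpace 𝕜 μ) : Prop :=
  ∀ (u : ℕ → X) (f : Ω →ₘ[μ] 𝕜), (∀ n, ‖u n‖ ≤ 1) → f ∈ LZero 𝕜 μ →
    (∀ s : Set Ω, MeasurableSet s → μ s < ⊤ →
      TendstoInMeasure (μ.restrict s) (fun n => ((u n : Ω →ₘ[μ] 𝕜) : Ω → 𝕜)) atTop f) →
    ∃ g : X, (g : Ω →ₘ[μ] 𝕜) = f ∧ ‖g‖ ≤ 1

/-- Reflexivity of the Banach space `X`. -/
def IsReflexive (X : KotheSpace 𝕜 μ) : Prop :=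
  Function.Surjective (NormedSpace.inclusionInDoubleDual 𝕜 X)

/-- `X` is 1-disjointly homogeneous: every normalized disjoint sequence in `X` has a subsequence
equivalent to the unit vector basis of `ℓ₁`. -/
def IsOneDH (X : KotheSpace 𝕜 μ) : Prop :=
  ∀ u : ℕ → X, (∀ n, ‖u n‖ = 1) →
    (∀ m n, m ≠ n → ∀ᵐ ω ∂μ, (u m : Ω →ₘ[μ] 𝕜) ω * (u n : Ω →ₘ[μ] 𝕜) ω = 0) →
    ∃ φ : ℕ → ℕ, StrictMono φ ∧ ∃ c C : ℝ, 0 < c ∧ 0 < C ∧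
      ∀ (s : Finset ℕ) (a : ℕ → 𝕜),
        c * ∑ k ∈ s, ‖a k‖ ≤ ‖∑ k ∈ s, a k • u (φ k)‖ ∧
        ‖∑ k ∈ s, a k • u (φ k)‖ ≤ C * ∑ k ∈ s, ‖a k‖

/-- The underlying vector space of `M(X,Y)`: all `f` in `L₀(μ)` with `f g ∈ Y` for all
`g ∈ X`. -/
def multSubmodule (X Y : KotheSpace 𝕜 μ) : Submodule 𝕜 (Ω →ₘ[μ] 𝕜) where
  carrier := {f | f ∈ LZero 𝕜 μ ∧ ∀ g ∈ X.toSubmodule, f * g ∈ Y.toSubmodule}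
  zero_mem' := ⟨zero_mem _, fun g _ => by
    have : (0 : Ω →ₘ[μ] 𝕜) * g = 0 := by
      apply AEEqFun.ext
      filter_upwards [AEEqFun.coeFn_mul 0 g, AEEqFun.coeFn_zero (β := 𝕜) (μ := μ)] with ω h1 h2
      rw [h1, Pi.mul_apply, h2]; simp
    rw [this]; exact zero_mem _⟩
  add_mem' := fun {f₁ f₂} h₁ h₂ => ⟨add_mem h₁.1 h₂.1, fun g hg => by
    have : (f₁ + f₂) * g = f₁ * g + f₂ * g := by
      apply AEEqFun.ext
      filter_upwards [AEEqFun.coeFn_mul (f₁ + f₂) g, AEEqFun.coeFn_add f₁ f₂,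
        AEEqFun.coeFn_mul f₁ g, AEEqFun.coeFn_mul f₂ g,
        AEEqFun.coeFn_add (f₁ * g) (f₂ * g)] with ω h1 h2 h3 h4 h5
      simp only [h1, h2, h3, h4, h5, Pi.mul_apply, Pi.add_apply]; ring
    rw [this]; exact add_mem (h₁.2 g hg) (h₂.2 g hg)⟩
  smul_mem' := fun c f h => ⟨Submodule.smul_mem _ c h.1, fun g hg => by
    have : (c • f) * g = c • (f * g) := by
      apply AEEqFun.ext
      filter_upwards [AEEqFun.coeFn_mul (c • f) g, AEEqFun.coeFn_smul c f,
        AEEqFun.coeFn_mul f g, AEEqFun.coeFn_smul c (f * g)] with ω h1 h2 h3 h4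
      simp only [h1, h2, h3, h4, Pi.mul_apply, Pi.smul_apply, smul_eq_mul]; ring
    rw [this]; exact Submodule.smul_mem _ c (h.2 g hg)⟩

/-- Multiplication by `lam ∈ M(X,Y)` as a linear map `X → Y`. -/
def mulLin (X Y : KotheSpace 𝕜 μ) (lam : multSubmodule X Y) : X →ₗ[𝕜] Y where
  toFun f := ⟨(lam : Ω →ₘ[μ] 𝕜) * (f : Ω →ₘ[μ] 𝕜), lam.2.2 f f.2⟩
  map_add' f g := by
    apply Subtype.ext
    apply AEEqFun.ext
    filter_upwards [AEEqFun.coeFn_mul (lam : Ω →ₘ[μ] 𝕜) (f + g : X),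
      AEEqFun.coeFn_add (f : Ω →ₘ[μ] 𝕜) g, AEEqFun.coeFn_mul (lam : Ω →ₘ[μ] 𝕜) f,
      AEEqFun.coeFn_mul (lam : Ω →ₘ[μ] 𝕜) g,
      AEEqFun.coeFn_add ((lam : Ω →ₘ[μ] 𝕜) * (f : Ω →ₘ[μ] 𝕜))
        ((lam : Ω →ₘ[μ] 𝕜) * (g : Ω →ₘ[μ] 𝕜))]
      with ω h1 h2 h3 h4 h5
    have h6 : ((f + g : X) : Ω →ₘ[μ] 𝕜) ω = _ := h2
    refine h1.trans (Eq.trans ?_ h5.symm)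
    simp only [h3, h4, h6, Pi.mul_apply, Pi.add_apply]; ring
  map_smul' c f := by
    apply Subtype.ext
    apply AEEqFun.ext
    filter_upwards [AEEqFun.coeFn_mul (lam : Ω →ₘ[μ] 𝕜) (c • f : X),
      AEEqFun.coeFn_smul c (f : Ω →ₘ[μ] 𝕜), AEEqFun.coeFn_mul (lam : Ω →ₘ[μ] 𝕜) f,
      AEEqFun.coeFn_smul c ((lam : Ω →ₘ[μ] 𝕜) * (f : Ω →ₘ[μ] 𝕜))] with ω h1 h2 h3 h4
    have h6 : ((c • f : X) : Ω →ₘ[μ] 𝕜) ω = _ := h2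
    refine h1.trans (Eq.trans ?_ h4.symm)
    simp only [h3, h6, Pi.mul_apply, Pi.smul_apply, smul_eq_mul]; ring

theorem coeFn_mulLin (X Y : KotheSpace 𝕜 μ) (lam : multSubmodule X Y) (f : X) :
    ∀ᵐ ω ∂μ, (mulLin X Y lam f : Ω →ₘ[μ] 𝕜) ω =
      (lam : Ω →ₘ[μ] 𝕜) ω * (f : Ω →ₘ[μ] 𝕜) ω :=
  AEEqFun.coeFn_mul (lam : Ω →ₘ[μ] 𝕜) (f : Ω →ₘ[μ] 𝕜)

theorem mulLin_bound (X Y : KotheSpace 𝕜 μ) (lam : multSubmodule X Y) :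
    ∃ C : ℝ, ∀ f : X, ‖mulLin X Y lam f‖ ≤ C * ‖f‖ := by
  by_contra! hcon
  choose f hf using fun n : ℕ => hcon (n * 2 ^ n)
  have hpos : ∀ n, 0 < ‖f n‖ := by
    intro n
    rw [norm_pos_iff]
    intro h0
    have := hf n
    simp [h0] at this
  have hq : ∀ n, 0 < 2 ^ n * ‖f n‖ := fun n => mul_pos (by positivity) (hpos n)
  let u : ℕ → X := fun n => X.abs ((((2 ^ n * ‖f n‖)⁻¹ : ℝ) : 𝕜) • f n)
  have hu : ∀ n, X.abs (u n) = u n := fun n => X.abs_abs _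
  have hun : ∀ n, ‖u n‖ = (1 / 2 : ℝ) ^ n := by
    intro n
    change ‖X.abs _‖ = _
    rw [X.norm_abs, norm_smul, RCLike.norm_ofReal, abs_of_pos (inv_pos.2 (hq n)), mul_inv,
      mul_assoc, inv_mul_cancel₀ (hpos n).ne']
    simp
  have hsum : Summable u := Summable.of_norm (by
    simp only [hun]; exact summable_geometric_two)
  have hle : ∀ n, X.abs (∑' k, u k - u n) = ∑' k, u k - u n := by
    intro n
    have hcl : IsClosed {g : X | X.abs g = g} := isClosed_eq X.continuous_abs continuous_id
    have ht : Tendsto (fun s : Finset ℕ => ∑ k ∈ s, u k - u n) atTop (𝓝 (∑' k, u k - u n)) :=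
      hsum.hasSum.sub_const (u n)
    refine hcl.mem_of_tendsto ht ?_
    filter_upwards [eventually_ge_atTop {n}] with s hs
    rw [← Finset.add_sum_erase s u (hs (Finset.mem_singleton_self n)), add_sub_cancel_left]
    exact X.abs_sum_of_abs u hu _
  have hle' : ∀ n, ∀ᵐ ω ∂μ, ‖(u n : Ω →ₘ[μ] 𝕜) ω‖ ≤
      ‖((∑' k, u k : X) : Ω →ₘ[μ] 𝕜) ω‖ := by
    intro n
    have h3 := X.coeFn_add' (∑' k, u k - u n) (u n)
    rw [sub_add_cancel] at h3
    have h1 := X.coeFn_abs (∑' k, u k - u n)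
    have h2 := X.coeFn_abs (u n)
    rw [hle] at h1
    rw [hu] at h2
    filter_upwards [h1, h2, h3] with ω h1 h2 h3
    rw [h3, h1, h2, ← RCLike.ofReal_add, RCLike.norm_ofReal, RCLike.norm_ofReal,
      abs_of_nonneg (by positivity), abs_of_nonneg (by positivity)]
    linarith [norm_nonneg (((∑' k, u k - u n : X) : Ω →ₘ[μ] 𝕜) ω)]
  have key : ∀ n : ℕ, (n : ℝ) ≤ ‖mulLin X Y lam (∑' k, u k)‖ := by
    intro n
    have hb : ‖mulLin X Y lam (f n)‖ ≤
        ‖(((2 ^ n * ‖f n‖ : ℝ) : 𝕜)) • mulLin X Y lam (∑' k, u k)‖ := by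
      apply Y.norm_le_of_ae_le
      filter_upwards [coeFn_mulLin X Y lam (f n), coeFn_mulLin X Y lam (∑' k, u k),
        Y.coeFn_smul' ((2 ^ n * ‖f n‖ : ℝ) : 𝕜) (mulLin X Y lam (∑' k, u k)), hle' n,
        X.coeFn_abs ((((2 ^ n * ‖f n‖)⁻¹ : ℝ) : 𝕜) • f n),
        X.coeFn_smul' (((2 ^ n * ‖f n‖)⁻¹ : ℝ) : 𝕜) (f n)] with ω h1 h2 h3 h4 h5 h6
      rw [h3, h1, h2, norm_mul, norm_mul, norm_mul, RCLike.norm_ofReal, abs_of_pos (hq n)]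
      have h7 : ‖(u n : Ω →ₘ[μ] 𝕜) ω‖ = (2 ^ n * ‖f n‖)⁻¹ * ‖(f n : Ω →ₘ[μ] 𝕜) ω‖ := by
        change ‖(X.abs _ : Ω →ₘ[μ] 𝕜) ω‖ = _
        rw [h5, h6, RCLike.norm_ofReal, abs_norm, norm_mul, RCLike.norm_ofReal,
          abs_of_pos (inv_pos.2 (hq n))]
      rw [h7, inv_mul_le_iff₀ (hq n)] at h4
      calc _ ≤ ‖(lam : Ω →ₘ[μ] 𝕜) ω‖ *
            (2 ^ n * ‖f n‖ * ‖((∑' k, u k : X) : Ω →ₘ[μ] 𝕜) ω‖) := by gcongr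
        _ = _ := by ring
    rw [norm_smul, RCLike.norm_ofReal, abs_of_pos (hq n)] at hb
    have h8 := (hf n).le.trans hb
    have h9 : (2 ^ n * ‖f n‖) * n ≤ (2 ^ n * ‖f n‖) * ‖mulLin X Y lam (∑' k, u k)‖ := by
      linarith
    exact le_of_mul_le_mul_left h9 (hq n)
  obtain ⟨n, hn⟩ := exists_nat_gt ‖mulLin X Y lam (∑' k, u k)‖
  exact absurd (key n) (not_le.2 hn)

/-- The multiplication operator `M_lam : X → Y`, `f ↦ lam f`, as a bounded operator. -/
noncomputable def mulCLM (X Y : KotheSpace 𝕜 μ) (lam : multSubmodule X Y) : X →L[𝕜] Y :=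
  (mulLin X Y lam).mkContinuousOfExistsBound (mulLin_bound X Y lam)

theorem coeFn_mulCLM (X Y : KotheSpace 𝕜 μ) (lam : multSubmodule X Y) (f : X) :
    ∀ᵐ ω ∂μ, (mulCLM X Y lam f : Ω →ₘ[μ] 𝕜) ω =
      (lam : Ω →ₘ[μ] 𝕜) ω * (f : Ω →ₘ[μ] 𝕜) ω :=
  coeFn_mulLin X Y lam f

theorem mulCLM_add (X Y : KotheSpace 𝕜 μ) (l₁ l₂ : multSubmodule X Y) :
    mulCLM X Y (l₁ + l₂) = mulCLM X Y l₁ + mulCLM X Y l₂ := by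
  refine ContinuousLinearMap.ext fun f => Subtype.ext (AEEqFun.ext ?_)
  filter_upwards [coeFn_mulCLM X Y (l₁ + l₂) f, coeFn_mulCLM X Y l₁ f, coeFn_mulCLM X Y l₂ f,
    Y.coeFn_add' (mulCLM X Y l₁ f) (mulCLM X Y l₂ f),
    AEEqFun.coeFn_add (l₁ : Ω →ₘ[μ] 𝕜) l₂] with ω h1 h2 h3 h4 h5
  rw [add_apply, h4, h1, h2, h3, Submodule.coe_add, h5, Pi.add_apply, add_mul]

theorem mulCLM_smul (X Y : KotheSpace 𝕜 μ) (c : 𝕜) (l : multSubmodule X Y) :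
    mulCLM X Y (c • l) = c • mulCLM X Y l := by
  refine ContinuousLinearMap.ext fun f => Subtype.ext (AEEqFun.ext ?_)
  filter_upwards [coeFn_mulCLM X Y (c • l) f, coeFn_mulCLM X Y l f,
    Y.coeFn_smul' c (mulCLM X Y l f),
    AEEqFun.coeFn_smul c (l : Ω →ₘ[μ] 𝕜)] with ω h1 h2 h4 h5
  rw [smul_apply, h4, h1, h2, Submodule.coe_smul, h5, Pi.smul_apply, smul_eq_mul, mul_assoc]

theorem eq_zero_of_mulCLM [SigmaFinite μ] (X Y : KotheSpace 𝕜 μ) (l : multSubmodule X Y)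
    (h : mulCLM X Y l = 0) : l = 0 := by
  apply Subtype.ext
  apply AEEqFun.ext
  have h1 : ∀ n, ∀ᵐ ω ∂μ, ω ∈ spanningSets μ n → (l : Ω →ₘ[μ] 𝕜) ω = 0 := by
    intro n
    have hm := measurableSet_spanningSets μ n
    let e : X := ⟨charFun 𝕜 μ (spanningSets μ n) hm,
      X.char_mem _ hm (measure_spanningSets_lt_top μ n)⟩
    have he : ∀ᵐ ω ∂μ, (e : Ω →ₘ[μ] 𝕜) ω = (spanningSets μ n).indicator (fun _ => (1 : 𝕜)) ω :=
      AEEqFun.coeFn_mk _ _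
    have h0 := coeFn_mulCLM X Y l e
    rw [h] at h0
    filter_upwards [h0, he, AEEqFun.coeFn_zero (β := 𝕜) (μ := μ)] with ω a b c hω
    have d : ((0 : Ω →ₘ[μ] 𝕜)) ω = (l : Ω →ₘ[μ] 𝕜) ω * (e : Ω →ₘ[μ] 𝕜) ω := a
    rw [b, c, Set.indicator_of_mem hω, mul_one] at d
    exact d.symm
  filter_upwards [ae_all_iff.2 h1, AEEqFun.coeFn_zero (β := 𝕜) (μ := μ)] with ω a c
  have hω : ω ∈ ⋃ n, spanningSets μ n := by rw [iUnion_spanningSets]; trivial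
  obtain ⟨n, hn⟩ := Set.mem_iUnion.1 hω
  rw [a n hn]
  exact c.symm

/-- The space of pointwise multipliers `M(X,Y)`, normed by
`‖lam‖ = sup {‖lam f‖_Y : ‖f‖_X ≤ 1}`, the operator norm of `M_lam`. -/
noncomputable def multipliers [SigmaFinite μ] (X Y : KotheSpace 𝕜 μ) : IdealSpace 𝕜 μ where
  toSubmodule := multSubmodule X Y
  le_LZero := fun _ h => h.1
  nrm := fun l => ‖mulCLM X Y l‖
  nrm_add_le := fun l₁ l₂ => by rw [mulCLM_add]; exact norm_add_le _ _
  nrm_smul := fun c l => by rw [mulCLM_smul, norm_smul]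
  eq_zero_of_nrm := fun l h => eq_zero_of_mulCLM X Y l (norm_eq_zero.1 h)
  ideal := fun f l hfl => by
    have hmul : ∀ g : Ω →ₘ[μ] 𝕜, ∀ᵐ ω ∂μ,
        ‖(f * g) ω‖ ≤ ‖((l : Ω →ₘ[μ] 𝕜) * g) ω‖ := by
      intro g
      filter_upwards [AEEqFun.coeFn_mul f g, AEEqFun.coeFn_mul (l : Ω →ₘ[μ] 𝕜) g, hfl]
        with ω h1 h2 h3
      rw [h1, h2, Pi.mul_apply, Pi.mul_apply, norm_mul, norm_mul]
      gcongr
    have hf : f ∈ multSubmodule X Y :=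
      ⟨fun s hs hμ => Integrable.mono (l.2.1 s hs hμ) f.aestronglyMeasurable.restrict
        (ae_restrict_of_ae hfl),
        fun g hg => (Y.ideal (f * g) ⟨_, l.2.2 g hg⟩ (hmul g)).1⟩
    refine ⟨hf, ContinuousLinearMap.opNorm_le_bound _ (norm_nonneg _) fun g => ?_⟩
    exact (Y.norm_le_of_ae_le (mulCLM X Y ⟨f, hf⟩ g) (mulCLM X Y l g) (hmul g)).trans
      ((mulCLM X Y l).le_opNorm g)

/-- The compact operators `X → Y`. -/
def compactOps (X Y : KotheSpace 𝕜 μ) : Set (X →L[𝕜] Y) := {T | IsCompactOperator T}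

/-- The weakly compact operators `X → Y`: bounded sets have relatively weakly compact image. -/
def weaklyCompactOps (X Y : KotheSpace 𝕜 μ) : Set (X →L[𝕜] Y) :=
  {T | ∀ S : Set X, Bornology.IsBounded S → IsCompact (closure (toWeakSpace 𝕜 Y '' (T '' S)))}

end KotheSpace

/-- Simple functions: finite linear combinations of characteristic functions of measurable sets
of finite measure. -/
noncomputable def simpleFunctions (𝕜 : Type*) [RCLike 𝕜] {Ω : Type*} [MeasurableSpace Ω]
    (μ : Measure Ω) : Submodule 𝕜 (Ω →ₘ[μ] 𝕜) :=
  Submodule.span 𝕜 {f | ∃ (s : Set Ω) (hs : MeasurableSet s), μ s < ⊤ ∧ f = charFun 𝕜 μ s hs}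

namespace IdealSpace

variable {𝕜 : Type*} [RCLike 𝕜] {Ω : Type*} [MeasurableSpace Ω] {μ : Measure Ω}

theorem exists_coeFn_eq_of_ae_le (X : IdealSpace 𝕜 μ) {F : Ω → 𝕜} (hF : AEStronglyMeasurable F μ)
    (g : X) (h : ∀ᵐ ω ∂μ, ‖F ω‖ ≤ ‖(g : Ω →ₘ[μ] 𝕜) ω‖) :
    ∃ f : X, (f : Ω →ₘ[μ] 𝕜) =ᵐ[μ] F := by
  refine ⟨⟨AEEqFun.mk F hF, (X.ideal _ g ?_).1⟩, AEEqFun.coeFn_mk F hF⟩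
  filter_upwards [h, AEEqFun.coeFn_mk F hF] with ω h1 h2
  rwa [h2]

theorem coe_ext (X : IdealSpace 𝕜 μ) {f g : X}
    (h : (f : Ω →ₘ[μ] 𝕜) =ᵐ[μ] (g : Ω →ₘ[μ] 𝕜)) : f = g :=
  Subtype.ext (AEEqFun.ext h)

theorem coeFn_zero' (X : IdealSpace 𝕜 μ) : ∀ᵐ ω ∂μ, ((0 : X) : Ω →ₘ[μ] 𝕜) ω = 0 :=
  AEEqFun.coeFn_zero (β := 𝕜)

/-- The element `χ_σ f` of `X`. -/
noncomputable def restrict (X : IdealSpace 𝕜 μ) {σ : Set Ω} (hσ : MeasurableSet σ) (f : X) : X :=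
  (X.exists_coeFn_eq_of_ae_le ((f : Ω →ₘ[μ] 𝕜).aestronglyMeasurable.indicator hσ) f
    (Eventually.of_forall fun _ => norm_indicator_le_norm_self _ _)).choose

theorem coeFn_restrict (X : IdealSpace 𝕜 μ) {σ : Set Ω} (hσ : MeasurableSet σ) (f : X) :
    ∀ᵐ ω ∂μ, (X.restrict hσ f : Ω →ₘ[μ] 𝕜) ω = σ.indicator (f : Ω →ₘ[μ] 𝕜) ω :=
  (X.exists_coeFn_eq_of_ae_le ((f : Ω →ₘ[μ] 𝕜).aestronglyMeasurable.indicator hσ) f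
    (Eventually.of_forall fun _ => norm_indicator_le_norm_self _ _)).choose_spec

open Classical in
/-- The band projection `f ↦ χ_σ f`; its value is zero if `σ` is not measurable. -/
noncomputable def proj (X : IdealSpace 𝕜 μ) (σ : Set Ω) : X →L[𝕜] X :=
  if hσ : MeasurableSet σ then
    LinearMap.mkContinuous
      { toFun := X.restrict hσ
        map_add' := fun f g => X.coe_ext (by
          filter_upwards [X.coeFn_restrict hσ (f + g), X.coeFn_restrict hσ f,
            X.coeFn_restrict hσ g, X.coeFn_add' f g,
            X.coeFn_add' (X.restrict hσ f) (X.restrict hσ g)] with ω h1 h2 h3 h4 h5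
          rw [h1, h5, h2, h3]
          by_cases h : ω ∈ σ <;> simp only [Set.indicator_of_mem, Set.indicator_of_notMem, h, h4,
            not_false_eq_true, add_zero])
        map_smul' := fun c f => X.coe_ext (by
          filter_upwards [X.coeFn_restrict hσ (c • f), X.coeFn_restrict hσ f,
            X.coeFn_smul' c f, X.coeFn_smul' c (X.restrict hσ f)] with ω h1 h2 h3 h4
          rw [RingHom.id_apply, h1, h4, h2]
          by_cases h : ω ∈ σ <;> simp only [Set.indicator_of_mem, Set.indicator_of_notMem, h, h3,
            not_false_eq_true, mul_zero]) } 1 (fun f => by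
          rw [one_mul]
          apply X.norm_le_of_ae_le
          filter_upwards [X.coeFn_restrict hσ f] with ω h
          exact h ▸ norm_indicator_le_norm_self _ _)
  else 0

theorem coeFn_proj (X : IdealSpace 𝕜 μ) {σ : Set Ω} (hσ : MeasurableSet σ) (f : X) :
    ∀ᵐ ω ∂μ, (X.proj σ f : Ω →ₘ[μ] 𝕜) ω = σ.indicator (f : Ω →ₘ[μ] 𝕜) ω := by
  rw [proj, dif_pos hσ]
  exact X.coeFn_restrict hσ f

theorem norm_proj_le (X : IdealSpace 𝕜 μ) (σ : Set Ω) (f : X) : ‖X.proj σ f‖ ≤ ‖f‖ := by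
  by_cases hσ : MeasurableSet σ
  · apply X.norm_le_of_ae_le
    filter_upwards [X.coeFn_proj hσ f] with ω h
    rw [h]
    exact norm_indicator_le_norm_self _ _
  · rw [proj, dif_neg hσ]; simp

theorem norm_proj_mono (X : IdealSpace 𝕜 μ) {σ τ : Set Ω} (hσ : MeasurableSet σ)
    (hτ : MeasurableSet τ) (h : σ ⊆ τ) (f : X) : ‖X.proj σ f‖ ≤ ‖X.proj τ f‖ := by
  apply X.norm_le_of_ae_le
  filter_upwards [X.coeFn_proj hσ f, X.coeFn_proj hτ f] with ω h1 h2
  rw [h1, h2]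
  exact norm_indicator_le_of_subset h _ _

theorem proj_proj (X : IdealSpace 𝕜 μ) {σ τ : Set Ω} (hσ : MeasurableSet σ)
    (hτ : MeasurableSet τ) (f : X) : X.proj σ (X.proj τ f) = X.proj (σ ∩ τ) f := by
  apply X.coe_ext
  filter_upwards [X.coeFn_proj hσ (X.proj τ f), X.coeFn_proj hτ f,
    X.coeFn_proj (hσ.inter hτ) f] with ω h1 h2 h3
  rw [h1, h3]
  by_cases a : ω ∈ σ <;> by_cases b : ω ∈ τ <;> simp [a, b, h2]

theorem proj_union (X : IdealSpace 𝕜 μ) {σ τ : Set Ω} (hσ : MeasurableSet σ)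
    (hτ : MeasurableSet τ) (hd : Disjoint σ τ) (f : X) :
    X.proj (σ ∪ τ) f = X.proj σ f + X.proj τ f := by
  apply X.coe_ext
  filter_upwards [X.coeFn_proj (hσ.union hτ) f, X.coeFn_proj hτ f, X.coeFn_proj hσ f,
    X.coeFn_add' (X.proj σ f) (X.proj τ f)] with ω h1 h2 h3 h4
  rw [h1, h4, h2, h3, Set.indicator_union_of_disjoint hd]

@[simp] theorem proj_empty (X : IdealSpace 𝕜 μ) (f : X) : X.proj ∅ f = 0 := by
  apply X.coe_ext
  filter_upwards [X.coeFn_proj MeasurableSet.empty f, X.coeFn_zero'] with ω h1 h2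
  rw [h1, h2, Set.indicator_empty]

theorem proj_univ (X : IdealSpace 𝕜 μ) (f : X) : X.proj Set.univ f = f := by
  apply X.coe_ext
  filter_upwards [X.coeFn_proj MeasurableSet.univ f] with ω h1
  rw [h1, Set.indicator_univ]

theorem proj_compl (X : IdealSpace 𝕜 μ) {σ : Set Ω} (hσ : MeasurableSet σ) (f : X) :
    X.proj σᶜ f = f - X.proj σ f := by
  rw [eq_sub_iff_add_eq', ← X.proj_union hσ hσ.compl disjoint_compl_right, Set.union_compl_self,
    proj_univ]

theorem proj_eq_zero_of_null (X : IdealSpace 𝕜 μ) {σ : Set Ω} (hσ : MeasurableSet σ)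
    (h : μ σ = 0) (f : X) : X.proj σ f = 0 := by
  apply X.coe_ext
  filter_upwards [X.coeFn_proj hσ f, X.coeFn_zero', measure_eq_zero_iff_ae_notMem.1 h]
    with ω h1 h2 h3
  rw [h1, h2, Set.indicator_of_notMem h3]

theorem proj_biUnion (X : IdealSpace 𝕜 μ) {D : ℕ → Set Ω} (hD : ∀ n, MeasurableSet (D n))
    (hd : Pairwise fun i j => Disjoint (D i) (D j)) (s : Finset ℕ) (f : X) :
    X.proj (⋃ i ∈ s, D i) f = ∑ i ∈ s, X.proj (D i) f := by
  induction s using Finset.induction_on with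
  | empty => simp
  | insert a s ha ih =>
    rw [Finset.sum_insert ha, ← ih, Finset.set_biUnion_insert]
    refine X.proj_union (hD a) (Finset.measurableSet_biUnion _ fun i _ => hD i) ?_ f
    rw [Set.disjoint_iUnion₂_right]
    intro i hi
    exact hd (fun h => ha (h ▸ hi))

theorem HasAbsContNorm.tendsto_proj {X : IdealSpace 𝕜 μ} {f : X} (h : X.HasAbsContNorm f)
    {σ : ℕ → Set Ω} (hσ : ∀ n, MeasurableSet (σ n)) (ha : Antitone σ) (h0 : μ (⋂ n, σ n) = 0) :
    Tendsto (fun n => ‖X.proj (σ n) f‖) atTop (𝓝 0) :=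
  h σ hσ ha h0 _ fun n => X.coeFn_proj (hσ n) f

theorem hasAbsContNorm_of_tendsto_proj {X : IdealSpace 𝕜 μ} {f : X}
    (h : ∀ σ : ℕ → Set Ω, (∀ n, MeasurableSet (σ n)) → Antitone σ → μ (⋂ n, σ n) = 0 →
      Tendsto (fun n => ‖X.proj (σ n) f‖) atTop (𝓝 0)) : X.HasAbsContNorm f := by
  intro σ hσ ha h0 g hg
  have : ∀ n, g n = X.proj (σ n) f := fun n => X.coe_ext <|
    (hg n).trans (EventuallyEq.symm (X.coeFn_proj (hσ n) f))
  simpa only [this] using h σ hσ ha h0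

theorem IsOrderContinuousElem.hasAbsContNorm {X : IdealSpace 𝕜 μ} {f : X}
    (h : X.IsOrderContinuousElem f) : X.HasAbsContNorm f := by
  refine hasAbsContNorm_of_tendsto_proj fun σ hσ ha h0 => ?_
  have := h (fun n => X.abs (X.proj (σ n) f)) ?_
  · simpa only [norm_abs] using this
  filter_upwards [ae_all_iff.2 fun n => X.coeFn_abs (X.proj (σ n) f),
    ae_all_iff.2 fun n => X.coeFn_proj (hσ n) f, measure_eq_zero_iff_ae_notMem.1 h0]
    with ω h1 h2 h3
  simp only [h1, h2, RCLike.norm_ofReal, _root_.abs_norm, true_and]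
  refine ⟨fun n => norm_indicator_le_norm_self _ _,
    fun m n hmn => norm_indicator_le_of_subset (ha hmn) _ _, ?_⟩
  simp only [Set.mem_iInter, not_forall] at h3
  obtain ⟨n, hn⟩ := h3
  refine tendsto_const_nhds.congr' ?_
  filter_upwards [eventually_ge_atTop n] with m hm
  rw [Set.indicator_of_notMem (fun h => hn (ha hm h)), norm_zero]

/-- Dominated convergence for a dominating element with absolutely continuous norm. -/
theorem HasAbsContNorm.tendsto_norm_of_dominated {X : IdealSpace 𝕜 μ} {w : X}
    (h : X.HasAbsContNorm w) {C : ℝ} (hC : 0 ≤ C) {v : ℕ → X}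
    (hv : ∀ᵐ ω ∂μ, (∀ n, ‖(v n : Ω →ₘ[μ] 𝕜) ω‖ ≤ C * ‖(w : Ω →ₘ[μ] 𝕜) ω‖) ∧
      Tendsto (fun n => ‖(v n : Ω →ₘ[μ] 𝕜) ω‖) atTop (𝓝 0)) :
    Tendsto (fun n => ‖v n‖) atTop (𝓝 0) := by
  rw [Metric.tendsto_atTop]
  intro ε hε
  set δ : ℝ := ε / (2 * (‖w‖ + 1)) with hδ
  have hw0 : 0 < ‖w‖ + 1 := by positivity
  have hδ0 : 0 < δ := by positivity
  set σ : ℕ → Set Ω := fun n =>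
    ⋃ m, ⋃ _ : n ≤ m, {ω | δ * ‖(w : Ω →ₘ[μ] 𝕜) ω‖ < ‖(v m : Ω →ₘ[μ] 𝕜) ω‖} with hσd
  have hσ : ∀ n, MeasurableSet (σ n) := fun n =>
    MeasurableSet.iUnion fun m => MeasurableSet.iUnion fun _ => measurableSet_lt
      ((AEEqFun.measurable (w : Ω →ₘ[μ] 𝕜)).norm.const_mul _)
      (AEEqFun.measurable (v m : Ω →ₘ[μ] 𝕜)).norm
  have hmem : ∀ n ω, ω ∈ σ n ↔
      ∃ m, n ≤ m ∧ δ * ‖(w : Ω →ₘ[μ] 𝕜) ω‖ < ‖(v m : Ω →ₘ[μ] 𝕜) ω‖ := fun n ω => by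
    simp only [hσd, Set.mem_iUnion, exists_prop]; rfl
  have ha : Antitone σ := fun n n' hn ω hω => by
    rw [hmem] at hω ⊢
    obtain ⟨m, hm, hm'⟩ := hω
    exact ⟨m, hn.trans hm, hm'⟩
  have h0 : μ (⋂ n, σ n) = 0 := by
    rw [measure_eq_zero_iff_ae_notMem]
    filter_upwards [hv] with ω ⟨h1, h2⟩ hω
    have hω' := fun n => (hmem n ω).1 (Set.mem_iInter.1 hω n)
    rcases (norm_nonneg ((w : Ω →ₘ[μ] 𝕜) ω)).eq_or_lt with h3 | h3
    · obtain ⟨m, -, hm⟩ := hω' 0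
      have := hm.trans_le (h1 m)
      simp [← h3] at this
    · obtain ⟨N, hN⟩ := eventually_atTop.1 (h2.eventually_lt_const (mul_pos hδ0 h3))
      obtain ⟨m, hNm, hm⟩ := hω' N
      exact (hN m hNm).not_gt hm
  have hlim := (h.tendsto_proj hσ ha h0).const_mul C
  rw [mul_zero] at hlim
  obtain ⟨N, hN⟩ := eventually_atTop.1 (hlim.eventually_lt_const (half_pos hε))
  refine ⟨N, fun n hn => ?_⟩
  rw [Real.dist_0_eq_abs, _root_.abs_norm]
  have hle : ‖v n‖ ≤ ‖((δ : ℝ) : 𝕜) • X.abs w + ((C : ℝ) : 𝕜) • X.abs (X.proj (σ n) w)‖ := by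
    apply X.norm_le_of_ae_le
    filter_upwards [X.coeFn_add' (((δ : ℝ) : 𝕜) • X.abs w) (((C : ℝ) : 𝕜) • X.abs (X.proj (σ n) w)),
      X.coeFn_smul' ((δ : ℝ) : 𝕜) (X.abs w), X.coeFn_abs w,
      X.coeFn_smul' ((C : ℝ) : 𝕜) (X.abs (X.proj (σ n) w)), X.coeFn_abs (X.proj (σ n) w),
      X.coeFn_proj (hσ n) w, hv] with ω h1 h2 h3 h4 h5 h6 ⟨h7, _⟩
    rw [h1, h2, h3, h4, h5, h6, ← RCLike.ofReal_mul, ← RCLike.ofReal_mul, ← RCLike.ofReal_add,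
      RCLike.norm_ofReal, abs_of_nonneg (by positivity)]
    by_cases hω : ω ∈ σ n
    · rw [Set.indicator_of_mem hω]
      exact (h7 n).trans (le_add_of_nonneg_left (by positivity))
    · rw [Set.indicator_of_notMem hω, norm_zero, mul_zero, add_zero]
      rw [hmem] at hω
      push Not at hω
      exact hω n le_rfl
  calc ‖v n‖ ≤ _ := hle
    _ ≤ ‖((δ : ℝ) : 𝕜) • X.abs w‖ + ‖((C : ℝ) : 𝕜) • X.abs (X.proj (σ n) w)‖ := norm_add_le _ _
    _ = δ * ‖w‖ + C * ‖X.proj (σ n) w‖ := by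
      rw [norm_smul, norm_smul, RCLike.norm_ofReal, RCLike.norm_ofReal, abs_of_pos hδ0,
        abs_of_nonneg hC, norm_abs, norm_abs]
    _ < ε / 2 + ε / 2 := by
      refine add_lt_add_of_le_of_lt ?_ (hN n hn)
      rw [hδ, div_mul_eq_mul_div, div_le_div_iff₀ (by positivity) (by positivity)]
      nlinarith [norm_nonneg w]
    _ = ε := by ring

theorem HasAbsContNorm.isOrderContinuousElem {X : IdealSpace 𝕜 μ} {f : X}
    (h : X.HasAbsContNorm f) : X.IsOrderContinuousElem f := fun g hg =>
  h.tendsto_norm_of_dominated zero_le_one <| hg.mono fun ω hω =>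
    ⟨fun n => by rw [one_mul]; exact (hω.1 n).2, hω.2.2⟩

theorem mem_ocPart_iff {X : IdealSpace 𝕜 μ} {f : X} : f ∈ X.ocPart ↔ X.HasAbsContNorm f :=
  ⟨IsOrderContinuousElem.hasAbsContNorm, HasAbsContNorm.isOrderContinuousElem⟩

theorem HasAbsContNorm.of_ae_le {X : IdealSpace 𝕜 μ} {f g : X} (hg : X.HasAbsContNorm g) {C : ℝ}
    (h : ∀ᵐ ω ∂μ, ‖(f : Ω →ₘ[μ] 𝕜) ω‖ ≤ C * ‖(g : Ω →ₘ[μ] 𝕜) ω‖) : X.HasAbsContNorm f := by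
  refine hasAbsContNorm_of_tendsto_proj fun σ hσ ha h0 => ?_
  refine squeeze_zero (fun _ => norm_nonneg _) (fun n => ?_)
    (by simpa using (hg.tendsto_proj hσ ha h0).const_mul |C|)
  have : ‖X.proj (σ n) f‖ ≤ ‖((|C| : ℝ) : 𝕜) • X.proj (σ n) g‖ := by
    apply X.norm_le_of_ae_le
    filter_upwards [X.coeFn_smul' ((|C| : ℝ) : 𝕜) (X.proj (σ n) g), X.coeFn_proj (hσ n) g,
      X.coeFn_proj (hσ n) f, h] with ω h1 h2 h3 h4
    rw [h1, h2, h3]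
    by_cases hω : ω ∈ σ n
    · simp only [Set.indicator_of_mem hω, norm_mul, RCLike.norm_ofReal, _root_.abs_abs]
      exact h4.trans (by gcongr; exact le_abs_self C)
    · simp [hω]
  rwa [norm_smul, RCLike.norm_ofReal, _root_.abs_abs] at this

theorem zero_mem_ocPart (X : IdealSpace 𝕜 μ) : (0 : X) ∈ X.ocPart :=
  mem_ocPart_iff.2 <| hasAbsContNorm_of_tendsto_proj fun σ _ _ _ => by simp

end IdealSpace

namespace KotheSpace

variable {𝕜 : Type*} [RCLike 𝕜] {Ω : Type*} [MeasurableSpace Ω] {μ : Measure Ω}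

/-- The multiplication operator of an element of the normed ideal space `M(X,Y)`. -/
noncomputable def mulOp [SigmaFinite μ] (X Y : KotheSpace 𝕜 μ) (l : multipliers X Y) :
    X →L[𝕜] Y := mulCLM X Y l

variable [SigmaFinite μ] (X Y : KotheSpace 𝕜 μ) (l : multipliers X Y)

theorem coeFn_mulOp (f : X) : ∀ᵐ ω ∂μ, (mulOp X Y l f : Ω →ₘ[μ] 𝕜) ω =
      (l : Ω →ₘ[μ] 𝕜) ω * (f : Ω →ₘ[μ] 𝕜) ω :=
  coeFn_mulCLM X Y l f

theorem mulOp_proj {σ : Set Ω} (hσ : MeasurableSet σ) (f : X) :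
    mulOp X Y ((multipliers X Y).proj σ l) f = mulOp X Y l (X.proj σ f) := by
  apply Y.coe_ext
  filter_upwards [coeFn_mulOp X Y ((multipliers X Y).proj σ l) f,
    coeFn_mulOp X Y l (X.proj σ f), X.coeFn_proj hσ f, (multipliers X Y).coeFn_proj hσ l]
    with ω h1 h2 h3 h4
  rw [h2, h3, h1, h4]
  by_cases h : ω ∈ σ <;> simp [h]

theorem proj_mulOp {σ : Set Ω} (hσ : MeasurableSet σ) (f : X) :
    Y.proj σ (mulOp X Y l f) = mulOp X Y l (X.proj σ f) := by
  apply Y.coe_ext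
  filter_upwards [coeFn_mulOp X Y l f, Y.coeFn_proj hσ (mulOp X Y l f),
    coeFn_mulOp X Y l (X.proj σ f), X.coeFn_proj hσ f] with ω h1 h2 h3 h4
  rw [h2, h3, h4]
  by_cases h : ω ∈ σ <;> simp [h, h1]

theorem norm_mulOp : ‖mulOp X Y l‖ = ‖l‖ := rfl

theorem mulOp_add (l₁ l₂ : multipliers X Y) :
    mulOp X Y (l₁ + l₂) = mulOp X Y l₁ + mulOp X Y l₂ :=
  mulCLM_add X Y l₁ l₂

theorem mulOp_sub (l₁ l₂ : multipliers X Y) :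
    mulOp X Y (l₁ - l₂) = mulOp X Y l₁ - mulOp X Y l₂ := by
  rw [eq_sub_iff_add_eq, ← mulOp_add, sub_add_cancel]

theorem dist_mulOp (l₁ l₂ : multipliers X Y) :
    dist (mulOp X Y l₁) (mulOp X Y l₂) = dist l₁ l₂ := by
  rw [dist_eq_norm, dist_eq_norm, ← mulOp_sub, norm_mulOp]

/-- If every order continuous multiplier gives an operator of a class, the distance to the class
is at most the distance to the order continuous part. -/
theorem infDist_mulOp_le (𝒜 : Set (X →L[𝕜] Y))
    (h : ∀ l ∈ (multipliers X Y).ocPart, mulOp X Y l ∈ 𝒜) :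
    Metric.infDist (mulOp X Y l) 𝒜 ≤ Metric.infDist l (multipliers X Y).ocPart := by
  refine (Metric.le_infDist ⟨0, (multipliers X Y).zero_mem_ocPart⟩).2 fun l' hl' => ?_
  rw [← dist_mulOp]
  exact Metric.infDist_le_dist_of_mem (h l' hl')

/-- If `χ_σ l` is order continuous, there are functions in the unit ball supported off `σ` on
which `M_l` is almost as large as the distance of `l` to the order continuous part. -/
theorem exists_lt_norm_mulOp_of_proj_mem_ocPart {σ : Set Ω} (hσ : MeasurableSet σ)
    (hl : (multipliers X Y).proj σ l ∈ (multipliers X Y).ocPart)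
    {r : ℝ} (hr : r < Metric.infDist l (multipliers X Y).ocPart) :
    ∃ f : X, ‖f‖ ≤ 1 ∧ X.proj σᶜ f = f ∧ r < ‖mulOp X Y l f‖ := by
  have h1 : Metric.infDist l (multipliers X Y).ocPart ≤ ‖(multipliers X Y).proj σᶜ l‖ := by
    rw [(multipliers X Y).proj_compl hσ, ← dist_eq_norm]
    exact Metric.infDist_le_dist_of_mem hl
  have h2 := hr.trans_le h1
  rw [← norm_mulOp] at h2
  obtain ⟨f, hf, hrf⟩ := ContinuousLinearMap.exists_lt_apply_of_lt_opNorm _ h2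
  rw [mulOp_proj X Y l hσ.compl] at hrf
  refine ⟨X.proj σᶜ f, (X.norm_proj_le _ f).trans hf.le, ?_, hrf⟩
  rw [X.proj_proj hσ.compl hσ.compl, Set.inter_self]

end KotheSpace

theorem exists_tendsto_strongDual_of_norm_le {𝕜 F ι : Type*} [RCLike 𝕜] [NormedAddCommGroup F]
    [NormedSpace 𝕜 F] (𝒰 : Ultrafilter ι) (y : ι → StrongDual 𝕜 F) {R : ℝ}
    (hy : ∀ᶠ i in (𝒰 : Filter ι), ‖y i‖ ≤ R) :
    ∃ L : StrongDual 𝕜 F, ‖L‖ ≤ R ∧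
      ∀ v, Tendsto (fun i => y i v) (𝒰 : Filter ι) (𝓝 (L v)) := by
  have hK := WeakDual.isCompact_closedBall (𝕜 := 𝕜) (0 : StrongDual 𝕜 F) R
  obtain ⟨L, hL, hle⟩ := hK.ultrafilter_le_nhds' (𝒰.map fun i => StrongDual.toWeakDual (y i)) (by
    rw [Ultrafilter.mem_map]
    filter_upwards [hy] with i hi
    simpa using hi)
  refine ⟨WeakDual.toStrongDual L, by simpa using hL, fun v => ?_⟩
  have h1 : Tendsto (fun i => StrongDual.toWeakDual (y i)) (𝒰 : Filter ι) (𝓝 L) := hle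
  exact ((WeakDual.eval_continuous v).tendsto L).comp h1

theorem exists_tendsto_bidual_of_norm_le {𝕜 E ι : Type*} [RCLike 𝕜] [NormedAddCommGroup E]
    [NormedSpace 𝕜 E] (𝒰 : Ultrafilter ι) (y : ι → E) {R : ℝ}
    (hy : ∀ᶠ i in (𝒰 : Filter ι), ‖y i‖ ≤ R) :
    ∃ L : StrongDual 𝕜 (StrongDual 𝕜 E), ‖L‖ ≤ R ∧
      ∀ φ : StrongDual 𝕜 E, Tendsto (fun i => φ (y i)) (𝒰 : Filter ι) (𝓝 (L φ)) :=
  exists_tendsto_strongDual_of_norm_le 𝒰 (fun i => NormedSpace.inclusionInDoubleDual 𝕜 E (y i)) <|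
    hy.mono fun i hi => (NormedSpace.double_dual_bound 𝕜 E (y i)).trans hi

/-- A measurable set that cannot be split into two parts of positive measure. -/
def IsIndecomposable {Ω : Type*} [MeasurableSpace Ω] (μ : Measure Ω) (B : Set Ω) : Prop :=
  MeasurableSet B ∧ ∀ C, MeasurableSet C → μ (B ∩ C) = 0 ∨ μ (B \ C) = 0

section Atomic

variable {Ω : Type*} [MeasurableSpace Ω] {μ : Measure Ω}

theorem IsIndecomposable.mono {B C : Set Ω} (hB : IsIndecomposable μ B) (hC : MeasurableSet C)
    (h : C ⊆ B) : IsIndecomposable μ C :=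
  ⟨hC, fun D hD => (hB.2 D hD).imp
    (fun h0 => measure_mono_null (Set.inter_subset_inter_left _ h) h0)
    (fun h0 => measure_mono_null (Set.sdiff_subset_sdiff_left h) h0)⟩

theorem IsAtomSet.isIndecomposable {A : Set Ω} (hA : IsAtomSet μ A) : IsIndecomposable μ A :=
  ⟨hA.1, fun C hC => (hA.2.2 (A ∩ C) Set.inter_subset_left (hA.1.inter hC)).imp_right
    (by rw [Set.sdiff_self_inter]; exact id)⟩

theorem IsPurelyAtomic.exists_seq [SigmaFinite μ] (h : IsPurelyAtomic μ) :
    ∃ D : ℕ → Set Ω, (∀ n, IsIndecomposable μ (D n)) ∧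
      (Pairwise fun i j => Disjoint (D i) (D j)) ∧ μ (⋃ n, D n)ᶜ = 0 := by
  suffices ∃ D : ℕ → Set Ω, (∀ n, IsIndecomposable μ (D n)) ∧ μ (⋃ n, D n)ᶜ = 0 by
    obtain ⟨D, hD, h0⟩ := this
    refine ⟨disjointed D, fun n => (hD n).mono (MeasurableSet.disjointed (fun i => (hD i).1) n)
      (disjointed_subset D n), disjoint_disjointed D, ?_⟩
    rwa [iUnion_disjointed]
  set ν := μ.toFinite
  let 𝒮 : Set (Set Ω) := {A | ∃ D : ℕ → Set Ω, (∀ n, IsIndecomposable μ (D n)) ∧ A = ⋃ n, D n}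
  have hne : (ν '' 𝒮).Nonempty :=
    ⟨_, _, ⟨fun _ => ∅, fun _ => ⟨MeasurableSet.empty, by simp⟩, rfl⟩, rfl⟩
  obtain ⟨u, -, hu, huS⟩ := exists_seq_tendsto_sSup hne (OrderTop.bddAbove _)
  choose A hA hAu using huS
  choose D hD hAD using hA
  let E : ℕ → Set Ω := fun k => D k.unpair.1 k.unpair.2
  have hE : ∀ k, IsIndecomposable μ (E k) := fun k => hD _ _
  have hAE : ∀ n, A n ⊆ ⋃ k, E k := by
    intro n
    rw [hAD n]
    refine Set.iUnion_subset fun m => ?_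
    have : E (Nat.pair n m) = D n m := by simp [E]
    exact this ▸ Set.subset_iUnion E _
  have hmax : sSup (ν '' 𝒮) ≤ ν (⋃ k, E k) := le_of_tendsto' hu fun n => by
    rw [← hAu n]
    exact measure_mono (hAE n)
  refine ⟨E, hE, ?_⟩
  by_contra hpos
  have hEm : MeasurableSet (⋃ k, E k) := MeasurableSet.iUnion fun k => (hE k).1
  obtain ⟨B, hBE, hB⟩ := h _ hEm.compl (pos_iff_ne_zero.2 hpos)
  have hmem : (⋃ k, E k) ∪ B ∈ 𝒮 := by
    refine ⟨fun n => Nat.casesOn n B E, fun n => ?_, ?_⟩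
    · cases n with
      | zero => exact hB.isIndecomposable
      | succ n => exact hE n
    · rw [Set.union_comm]
      ext ω
      simp only [Set.mem_union, Set.mem_iUnion]
      constructor
      · rintro (h | ⟨n, h⟩)
        · exact ⟨0, h⟩
        · exact ⟨n + 1, h⟩
      · rintro ⟨n, h⟩
        cases n with
        | zero => exact Or.inl h
        | succ n => exact Or.inr ⟨n, h⟩
  have h1 : ν ((⋃ k, E k) ∪ B) ≤ ν (⋃ k, E k) := (le_sSup (Set.mem_image_of_mem ν hmem)).trans hmax
  rw [measure_union (Set.disjoint_left.2 fun ω h1 h2 => hBE h2 h1) hB.1] at h1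
  have h2 : ν B = 0 := by
    by_contra hc
    exact (ENNReal.lt_add_right (measure_ne_top ν _) hc).not_ge h1
  exact hB.2.1.ne' (absolutelyContinuous_toFinite μ h2)

theorem IsIndecomposable.exists_ae_eq_const {𝕜 : Type*} [RCLike 𝕜] {B : Set Ω}
    (hB : IsIndecomposable μ B) {f : Ω → 𝕜} (hf : Measurable f) :
    ∃ c, ∀ᵐ ω ∂μ, ω ∈ B → f ω = c := by
  obtain ⟨c, hc⟩ := Filter.exists_eventuallyEq_const_of_forall_separating (l := ae (μ.restrict B))
    (f := f) MeasurableSet (fun U hU => by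
      rw [ae_restrict_iff' hB.1, ae_restrict_iff' hB.1]
      rcases hB.2 _ (hf hU) with h | h
      · right
        filter_upwards [measure_eq_zero_iff_ae_notMem.1 h] with ω h1 h2 h3
        exact h1 ⟨h2, h3⟩
      · left
        filter_upwards [measure_eq_zero_iff_ae_notMem.1 h] with ω h1 h2
        by_contra h3
        exact h1 ⟨h2, h3⟩)
  exact ⟨c, (ae_restrict_iff' hB.1).1 hc⟩

theorem IsIndecomposable.exists_subset_measure_lt_top [SigmaFinite μ] {B : Set Ω}
    (hB : IsIndecomposable μ B) :
    ∃ C ⊆ B, MeasurableSet C ∧ μ C < ⊤ ∧ μ (B \ C) = 0 := by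
  by_cases h0 : ∃ k, μ (B ∩ spanningSets μ k) ≠ 0
  · obtain ⟨k, hk⟩ := h0
    refine ⟨B ∩ spanningSets μ k, Set.inter_subset_left,
      hB.1.inter (measurableSet_spanningSets μ k),
      (measure_mono Set.inter_subset_right).trans_lt (measure_spanningSets_lt_top μ k), ?_⟩
    rw [Set.sdiff_self_inter]
    exact (hB.2 _ (measurableSet_spanningSets μ k)).resolve_left hk
  · push Not at h0
    refine ⟨∅, Set.empty_subset _, MeasurableSet.empty, by simp, ?_⟩
    rw [Set.sdiff_empty, ← Set.inter_univ B, ← iUnion_spanningSets μ, Set.inter_iUnion]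
    exact measure_iUnion_null h0

end Atomic

namespace IdealSpace

variable {𝕜 : Type*} [RCLike 𝕜] {Ω : Type*} [MeasurableSpace Ω] {μ : Measure Ω}

theorem hasAbsContNorm_proj_of_isIndecomposable (X : IdealSpace 𝕜 μ) {B : Set Ω}
    (hB : IsIndecomposable μ B) (f : X) : X.HasAbsContNorm (X.proj B f) := by
  refine hasAbsContNorm_of_tendsto_proj fun σ hσ ha h0 => ?_
  by_cases hB0 : μ B = 0
  · simp [X.proj_eq_zero_of_null hB.1 hB0]
  have : ∃ n, μ (B ∩ σ n) = 0 := by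
    by_contra! hcon
    have h1 : ∀ n, μ (B \ σ n) = 0 := fun n => (hB.2 _ (hσ n)).resolve_left (hcon n)
    refine hB0 (measure_mono_null ?_ (measure_union_null (measure_iUnion_null h1) h0))
    intro ω hω
    by_cases h : ω ∈ ⋂ n, σ n
    · exact Or.inr h
    · simp only [Set.mem_iInter, not_forall] at h
      obtain ⟨n, hn⟩ := h
      exact Or.inl (Set.mem_iUnion.2 ⟨n, hω, hn⟩)
  obtain ⟨n, hn⟩ := this
  refine tendsto_const_nhds.congr' ?_
  filter_upwards [eventually_ge_atTop n] with m hm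
  rw [X.proj_proj (hσ m) hB.1, Set.inter_comm, X.proj_eq_zero_of_null (hB.1.inter (hσ m))
    (measure_mono_null (Set.inter_subset_inter_right _ (ha hm)) hn), norm_zero]

theorem HasAbsContNorm.add {X : IdealSpace 𝕜 μ} {f g : X} (hf : X.HasAbsContNorm f)
    (hg : X.HasAbsContNorm g) : X.HasAbsContNorm (f + g) := by
  refine hasAbsContNorm_of_tendsto_proj fun σ hσ ha h0 => ?_
  refine squeeze_zero (fun _ => norm_nonneg _) (fun n => ?_)
    (by simpa using (hf.tendsto_proj hσ ha h0).add (hg.tendsto_proj hσ ha h0))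
  rw [map_add]
  exact norm_add_le _ _

theorem HasAbsContNorm.sum {X : IdealSpace 𝕜 μ} {ι : Type*} (s : Finset ι) {f : ι → X}
    (hf : ∀ i ∈ s, X.HasAbsContNorm (f i)) : X.HasAbsContNorm (∑ i ∈ s, f i) := by
  classical
  induction s using Finset.induction_on with
  | empty => exact mem_ocPart_iff.1 X.zero_mem_ocPart
  | insert a s ha ih =>
    rw [Finset.sum_insert ha]
    exact (hf a (Finset.mem_insert_self a s)).add
      (ih fun i hi => hf i (Finset.mem_insert_of_mem hi))

end IdealSpace

namespace KotheSpace

variable {𝕜 : Type*} [RCLike 𝕜] {Ω : Type*} [MeasurableSpace Ω] {μ : Measure Ω} [SigmaFinite μ]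
  (X Y : KotheSpace 𝕜 μ) (l : multipliers X Y)

theorem isCompactOperator_mulOp_proj {B : Set Ω} (hB : IsIndecomposable μ B) :
    IsCompactOperator (mulOp X Y ((multipliers X Y).proj B l)) := by
  obtain ⟨C, hCB, hC, hCfin, hBC⟩ := hB.exists_subset_measure_lt_top
  let e : Y := ⟨_root_.charFun 𝕜 μ C hC, Y.char_mem C hC hCfin⟩
  have he : ∀ᵐ ω ∂μ, (e : Ω →ₘ[μ] 𝕜) ω = C.indicator (fun _ => (1 : 𝕜)) ω :=
    AEEqFun.coeFn_mk _ _
  set T := mulOp X Y ((multipliers X Y).proj B l) with hT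
  have hmem : ∀ f, T f ∈ Submodule.span 𝕜 {e} := by
    intro f
    obtain ⟨c, hc⟩ := hB.exists_ae_eq_const
      (f := fun ω => (l : Ω →ₘ[μ] 𝕜) ω * (f : Ω →ₘ[μ] 𝕜) ω)
      ((AEEqFun.measurable _).mul (AEEqFun.measurable _))
    refine Submodule.mem_span_singleton.2 ⟨c, Y.coe_ext ?_⟩
    filter_upwards [coeFn_mulOp X Y ((multipliers X Y).proj B l) f,
      (multipliers X Y).coeFn_proj hB.1 l, Y.coeFn_smul' c e, he, hc,
      measure_eq_zero_iff_ae_notMem.1 hBC] with ω h1 h2 h3 h4 h5 h6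
    rw [h3, h4, h1, h2]
    by_cases hω : ω ∈ C
    · simp [hω, hCB hω, h5 (hCB hω)]
    · have : ω ∉ B := fun h => h6 ⟨h, hω⟩
      simp [hω, this]
  have hp : ProperSpace (Submodule.span 𝕜 {e}) := FiniteDimensional.proper 𝕜 _
  have h1 : IsCompactOperator (T.codRestrict _ hmem) :=
    isCompactOperator_of_locallyCompactSpace_dom (T.codRestrict _ hmem)
  exact h1.clm_comp (Submodule.span 𝕜 {e}).subtypeL

theorem isCompactOperator_mulOp_sum (s : Finset ℕ) {D : ℕ → Set Ω}
    (hD : ∀ n, IsIndecomposable μ (D n)) :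
    IsCompactOperator (mulOp X Y (∑ i ∈ s, (multipliers X Y).proj (D i) l)) := by
  induction s using Finset.induction_on with
  | empty =>
    have : mulOp X Y (∑ i ∈ (∅ : Finset ℕ), (multipliers X Y).proj (D i) l) = 0 := by
      rw [Finset.sum_empty, ← norm_eq_zero, norm_mulOp, norm_zero]
    rw [this]
    exact isCompactOperator_zero
  | insert a s ha ih =>
    rw [Finset.sum_insert ha, mulOp_add]
    exact (isCompactOperator_mulOp_proj X Y l (hD a)).add ih

end KotheSpace

section

variable {Ω : Type*} {D : ℕ → Set Ω}

theorem measurableSet_biUnion_range [MeasurableSpace Ω] (hD : ∀ n, MeasurableSet (D n)) (n : ℕ) :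
    MeasurableSet (⋃ i ∈ Finset.range n, D i) :=
  Finset.measurableSet_biUnion _ fun i _ => hD i

theorem antitone_compl_biUnion_range : Antitone fun n => (⋃ i ∈ Finset.range n, D i)ᶜ :=
  fun _ _ hmn => Set.compl_subset_compl.2 <|
    Set.biUnion_subset_biUnion_left (Finset.range_subset_range.2 hmn)

theorem iInter_compl_biUnion_range : ⋂ n, (⋃ i ∈ Finset.range n, D i)ᶜ = (⋃ i, D i)ᶜ := by
  ext ω
  simp only [Set.mem_iInter, Set.mem_compl_iff, Set.mem_iUnion, Finset.mem_range, not_exists]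
  exact ⟨fun h i hi => h (i + 1) i (Nat.lt_succ_self i) hi, fun h n i _ => h i⟩

end

namespace KotheSpace

variable {𝕜 : Type*} [RCLike 𝕜] {Ω : Type*} [MeasurableSpace Ω] {μ : Measure Ω}

/-- In a reflexive Köthe space, bounded sequences that vanish on more and more of the pieces of
a countable partition are weakly null. -/
theorem tendsto_dual_of_isReflexive (X : KotheSpace 𝕜 μ) (hX : X.IsReflexive) {D : ℕ → Set Ω}
    (hD : ∀ n, MeasurableSet (D n)) (h0 : μ (⋃ n, D n)ᶜ = 0) {f : ℕ → X} (hf : ∀ n, ‖f n‖ ≤ 1)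
    (hfD : ∀ i, ∀ᶠ n in atTop, X.proj (D i) (f n) = 0) (𝒰 : Ultrafilter ℕ)
    (h𝒰 : (𝒰 : Filter ℕ) ≤ atTop) (φ : StrongDual 𝕜 X) :
    Tendsto (fun n => φ (f n)) (𝒰 : Filter ℕ) (𝓝 0) := by
  obtain ⟨L, -, hL⟩ := exists_tendsto_bidual_of_norm_le (𝕜 := 𝕜) 𝒰 f (Eventually.of_forall hf)
  obtain ⟨z, rfl⟩ := hX L
  have hz : ∀ i, X.proj (D i) z = 0 := by
    intro i
    refine SeparatingDual.eq_zero_of_forall_dual_eq_zero (R := 𝕜) fun ψ => ?_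
    have h1 := hL (ψ.comp (X.proj (D i)))
    refine tendsto_nhds_unique h1 (tendsto_const_nhds.congr' ?_)
    filter_upwards [h𝒰 (hfD i)] with n hn
    simp [hn]
  have hz0 : z = 0 := by
    apply X.coe_ext
    filter_upwards [X.coeFn_zero', ae_all_iff.2 fun i => X.coeFn_proj (hD i) z,
      measure_eq_zero_iff_ae_notMem.1 h0] with ω h1 h2 h3
    obtain ⟨i, hi⟩ := Set.mem_iUnion.1 (not_not.1 h3)
    have := h2 i
    rw [hz i, h1, Set.indicator_of_mem hi] at this
    rw [h1, ← this]
  have := hL φ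
  rw [hz0, map_zero] at this
  exact this

variable [SigmaFinite μ] (X Y : KotheSpace 𝕜 μ) (l : multipliers X Y)

theorem isCompactOperator_mulOp (hμ : IsPurelyAtomic μ) (hl : l ∈ (multipliers X Y).ocPart) :
    IsCompactOperator (mulOp X Y l) := by
  obtain ⟨D, hD, hd, h0⟩ := hμ.exists_seq
  have hm := measurableSet_biUnion_range fun n => (hD n).1
  refine isCompactOperator_of_tendsto (l := atTop) (𝕜₁ := 𝕜) (𝕜₂ := 𝕜)
    (F := fun n => mulOp X Y ((multipliers X Y).proj (⋃ i ∈ Finset.range n, D i) l))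
    ?_ (Eventually.of_forall fun n => ?_)
  · rw [tendsto_iff_dist_tendsto_zero]
    refine ((IdealSpace.mem_ocPart_iff.1 hl).tendsto_proj (fun n => (hm n).compl)
      antitone_compl_biUnion_range (by rwa [iInter_compl_biUnion_range])).congr fun n => ?_
    rw [dist_mulOp, dist_comm, dist_eq_norm, (multipliers X Y).proj_compl (hm n)]
  · rw [(multipliers X Y).proj_biUnion (fun n => (hD n).1) hd]
    exact isCompactOperator_mulOp_sum X Y l _ hD

theorem infDist_ocPart_le_dist_of_isCompactOperator (hμ : IsPurelyAtomic μ)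
    (h : X.IsReflexive ∨ Y.IsOrderContinuous) {K : X →L[𝕜] Y} (hK : IsCompactOperator K) :
    Metric.infDist l (multipliers X Y).ocPart ≤ dist (mulOp X Y l) K := by
  obtain ⟨D, hD, hd, h0⟩ := hμ.exists_seq
  have hm := measurableSet_biUnion_range fun n => (hD n).1
  by_contra! hlt
  obtain ⟨r, hr1, hr2⟩ := exists_between hlt
  have hoc : ∀ n, (multipliers X Y).proj (⋃ i ∈ Finset.range n, D i) l ∈
      (multipliers X Y).ocPart := by
    intro n
    rw [(multipliers X Y).proj_biUnion (fun n => (hD n).1) hd, IdealSpace.mem_ocPart_iff]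
    exact IdealSpace.HasAbsContNorm.sum _ fun i _ =>
      IdealSpace.hasAbsContNorm_proj_of_isIndecomposable _ (hD i) l
  choose f hf1 hf2 hf3 using fun n =>
    exists_lt_norm_mulOp_of_proj_mem_ocPart X Y l (hm n) (hoc n) hr2
  set τ : ℕ → Set Ω := fun n => (⋃ i ∈ Finset.range n, D i)ᶜ with hτ
  have hτm : ∀ n, MeasurableSet (τ n) := fun n => (hm n).compl
  set 𝒰 : Ultrafilter ℕ := hyperfilter ℕ
  have h𝒰 : (𝒰 : Filter ℕ) ≤ atTop := Nat.hyperfilter_le_atTop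
  have hbd : ∀ n, r - dist (mulOp X Y l) K ≤ ‖Y.proj (τ n) (K (f n))‖ := by
    intro n
    have h1 : mulOp X Y l (f n) =
        Y.proj (τ n) ((mulOp X Y l - K) (f n)) + Y.proj (τ n) (K (f n)) := by
      rw [← map_add, sub_apply, sub_add_cancel, proj_mulOp X Y l (hτm n), hf2 n]
    have h2 : ‖Y.proj (τ n) ((mulOp X Y l - K) (f n))‖ ≤ dist (mulOp X Y l) K := by
      rw [dist_eq_norm]
      exact (Y.norm_proj_le _ _).trans ((mulOp X Y l - K).unit_le_opNorm _ (hf1 n))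
    have h3 := hf3 n
    rw [h1] at h3
    linarith [norm_add_le (Y.proj (τ n) ((mulOp X Y l - K) (f n))) (Y.proj (τ n) (K (f n)))]
  have hcpt := hK.isCompact_closure_image_closedBall (f := K.toLinearMap) 1
  obtain ⟨z, -, hz⟩ := hcpt.ultrafilter_le_nhds' (𝒰.map fun n => K (f n)) (by
    rw [Ultrafilter.mem_map]
    exact univ_mem' fun n => subset_closure ⟨f n, by simpa using hf1 n, rfl⟩)
  have hz : Tendsto (fun n => K (f n)) (𝒰 : Filter ℕ) (𝓝 z) := hz
  have hlim : Tendsto (fun n => ‖Y.proj (τ n) z‖) (𝒰 : Filter ℕ) (𝓝 0) := by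
    rcases h with hX | hY
    · have hz0 : z = 0 := by
        refine SeparatingDual.eq_zero_of_forall_dual_eq_zero (R := 𝕜) fun ψ => ?_
        refine tendsto_nhds_unique ((ψ.continuous.tendsto z).comp hz) ?_
        refine tendsto_dual_of_isReflexive X hX (fun n => (hD n).1) h0 hf1 (fun i => ?_) 𝒰 h𝒰
          (ψ.comp K)
        filter_upwards [eventually_gt_atTop i] with n hn
        rw [← hf2 n, X.proj_proj (hD i).1 (hτm n)]
        have : D i ∩ τ n = ∅ := by
          rw [← Set.disjoint_iff_inter_eq_empty, Set.disjoint_compl_right_iff_subset]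
          exact Set.subset_biUnion_of_mem (u := D) (Finset.mem_coe.2 (Finset.mem_range.2 hn))
        rw [this, X.proj_empty]
      simp [hz0]
    · have hz' : z ∈ Y.ocPart := by
        have : Y.ocPart = Set.univ := hY
        rw [this]; trivial
      exact ((IdealSpace.mem_ocPart_iff.1 hz').tendsto_proj hτm antitone_compl_biUnion_range
        (by rwa [iInter_compl_biUnion_range])).mono_left h𝒰
  have hlim2 : Tendsto (fun n => ‖K (f n) - z‖ + ‖Y.proj (τ n) z‖) (𝒰 : Filter ℕ) (𝓝 0) := by
    simpa using (tendsto_iff_norm_sub_tendsto_zero.1 hz).add hlim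
  have := ge_of_tendsto hlim2 (Eventually.of_forall fun n => (hbd n).trans (b := _) (by
    have h1 : Y.proj (τ n) (K (f n)) = Y.proj (τ n) (K (f n) - z) + Y.proj (τ n) z := by
      rw [← map_add, sub_add_cancel]
    rw [h1]
    exact (norm_add_le _ _).trans (add_le_add_left (Y.norm_proj_le _ _) _)))
  linarith

theorem infDist_compactOps_eq (hμ : IsPurelyAtomic μ) (h : X.IsReflexive ∨ Y.IsOrderContinuous) :
    Metric.infDist (mulOp X Y l) (compactOps X Y) =
      Metric.infDist l (multipliers X Y).ocPart :=
  le_antisymm (infDist_mulOp_le X Y l _ fun l' hl' => isCompactOperator_mulOp X Y l' hμ hl') <|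
    (Metric.le_infDist ⟨0, isCompactOperator_zero⟩).2 fun _ hK =>
      infDist_ocPart_le_dist_of_isCompactOperator X Y l hμ h hK

end KotheSpace

theorem Antitone.pairwise_disjoint_sdiff {Ω : Type*} {σ : ℕ → Set Ω} (h : Antitone σ) {κ : ℕ → ℕ}
    (hκ : StrictMono κ) :
    Pairwise fun i j => Disjoint (σ (κ i) \ σ (κ (i + 1))) (σ (κ j) \ σ (κ (j + 1))) := by
  suffices H : ∀ i j, i < j → Disjoint (σ (κ i) \ σ (κ (i + 1))) (σ (κ j) \ σ (κ (j + 1))) by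
    intro i j hij
    rcases lt_or_gt_of_ne hij with h1 | h1
    · exact H i j h1
    · exact (H j i h1).symm
  intro i j hij
  rw [Set.disjoint_left]
  intro ω h1 h2
  exact h1.2 (h (hκ.monotone hij) h2.1)

/-- A functional whose real part is bounded below on a sequence dominating the unit vector basis
of `ℓ₁`. -/
theorem exists_dual_le_re_of_lower_l1 {𝕜 E : Type*} [RCLike 𝕜] [NormedAddCommGroup E]
    [NormedSpace 𝕜 E] (v : ℕ → E) {c : ℝ} (hc : 0 < c)
    (h : ∀ (s : Finset ℕ) (a : ℕ → 𝕜), c * ∑ k ∈ s, ‖a k‖ ≤ ‖∑ k ∈ s, a k • v k‖) :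
    ∃ (ψ : StrongDual 𝕜 E) (u : ℝ), 0 < u ∧ ∀ k, u ≤ RCLike.re (ψ (v k)) := by
  let _ : NormedSpace ℝ E := NormedSpace.restrictScalars ℝ 𝕜 E
  have : IsScalarTower ℝ 𝕜 E := ⟨fun r a x => by
    rw [RCLike.real_smul_eq_coe_mul, mul_smul]; rfl⟩
  let C : Set (ℕ →₀ ℝ) := {a | (∀ i, 0 ≤ a i) ∧ a.sum (fun _ t => t) = 1}
  have hC : Convex ℝ C := by
    intro a ha b hb s t hs ht hst
    refine ⟨fun i => ?_, ?_⟩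
    · have := ha.1 i
      have := hb.1 i
      simp only [Finsupp.coe_add, Finsupp.coe_smul, Pi.add_apply, Pi.smul_apply, smul_eq_mul]
      positivity
    · rw [Finsupp.sum_add_index' (fun _ => rfl) (fun _ _ _ => rfl),
        Finsupp.sum_smul_index' (fun _ => rfl), Finsupp.sum_smul_index' (fun _ => rfl)]
      have h1 : a.sum (fun _ x => s • x) = s := by
        rw [← Finsupp.smul_sum, ha.2, smul_eq_mul, mul_one]
      have h2 : b.sum (fun _ x => t • x) = t := by
        rw [← Finsupp.smul_sum, hb.2, smul_eq_mul, mul_one]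
      rw [h1, h2, hst]
  have hdisj : Disjoint (Metric.ball (0 : E) c) (Finsupp.linearCombination ℝ v '' C) := by
    rw [Set.disjoint_left]
    rintro _ hx ⟨a, ha, rfl⟩
    rw [mem_ball_zero_iff] at hx
    refine hx.not_ge ?_
    have h1 := h a.support (fun k => ((a k : ℝ) : 𝕜))
    have h2 : ∑ k ∈ a.support, ‖((a k : ℝ) : 𝕜)‖ = 1 := by
      rw [← ha.2, Finsupp.sum]
      exact Finset.sum_congr rfl fun k _ => by rw [RCLike.norm_ofReal, abs_of_nonneg (ha.1 k)]
    rw [h2, mul_one] at h1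
    exact h1
  obtain ⟨ψ, u, h1, h2⟩ := RCLike.geometric_hahn_banach_open (𝕜 := 𝕜) (convex_ball (0 : E) c)
    Metric.isOpen_ball (hC.linear_image _) hdisj
  refine ⟨ψ, u, ?_, fun k => ?_⟩
  · simpa using h1 0 (Metric.mem_ball_self hc)
  · refine h2 _ ⟨Finsupp.single k 1, ⟨fun i => ?_, ?_⟩, ?_⟩
    · rw [Finsupp.single_apply]; split_ifs <;> norm_num
    · simp
    · simp

namespace KotheSpace

variable {𝕜 : Type*} [RCLike 𝕜] {Ω : Type*} [MeasurableSpace Ω] {μ : Measure Ω}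
  {Y : KotheSpace 𝕜 μ}

theorem HasFatou.norm_proj_le (hY : Y.HasFatou) {σ : ℕ → Set Ω} (hσ : ∀ n, MeasurableSet (σ n))
    (ha : Antitone σ) (h0 : μ (⋂ n, σ n) = 0) {τ : Set Ω} (hτ : MeasurableSet τ) (y : Y) {c : ℝ}
    (hc : 0 < c) (h : ∀ n, ‖Y.proj (τ \ σ n) y‖ ≤ c) : ‖Y.proj τ y‖ ≤ c := by
  obtain ⟨g, hg, hg1⟩ := hY (fun n => ((c⁻¹ : ℝ) : 𝕜) • Y.proj (τ \ σ n) y)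
    (((c⁻¹ : ℝ) : 𝕜) • Y.proj τ y : Y) (fun n => by
      rw [norm_smul, RCLike.norm_ofReal, abs_of_pos (inv_pos.2 hc), inv_mul_le_iff₀ hc, mul_one]
      exact h n) (Y.le_LZero (Subtype.mem _)) (fun s hs hμs => by
      have : IsFiniteMeasure (μ.restrict s) := ⟨by simpa using hμs⟩
      refine tendstoInMeasure_of_tendsto_ae
        (fun n => (AEEqFun.aestronglyMeasurable _).restrict) (ae_restrict_of_ae ?_)
      filter_upwards [ae_all_iff.2 fun n => Y.coeFn_smul' ((c⁻¹ : ℝ) : 𝕜) (Y.proj (τ \ σ n) y),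
        Y.coeFn_smul' ((c⁻¹ : ℝ) : 𝕜) (Y.proj τ y), Y.coeFn_proj hτ y,
        ae_all_iff.2 fun n => Y.coeFn_proj (hτ.diff (hσ n)) y,
        measure_eq_zero_iff_ae_notMem.1 h0] with ω h1 h2 h3 h4 h5
      simp only [Set.mem_iInter, not_forall] at h5
      obtain ⟨n, hn⟩ := h5
      refine tendsto_const_nhds.congr' ?_
      filter_upwards [eventually_ge_atTop n] with m hm
      have hωm : ω ∉ σ m := fun h => hn (ha hm h)
      rw [h1, h2, h3, h4]
      by_cases hω : ω ∈ τ <;> simp [hω, hωm])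
  have hg' : g = ((c⁻¹ : ℝ) : 𝕜) • Y.proj τ y := Subtype.ext hg
  rw [hg', norm_smul, RCLike.norm_ofReal, abs_of_pos (inv_pos.2 hc), inv_mul_le_iff₀ hc,
    mul_one] at hg1
  exact hg1

theorem IsOneDH.exists_subseq_lower_l1 (hY : Y.IsOneDH) {v : ℕ → Y} {δ : ℝ} (hδ : 0 < δ)
    (hv : ∀ n, δ ≤ ‖v n‖) (hd : ∀ m n, m ≠ n →
      ∀ᵐ ω ∂μ, (v m : Ω →ₘ[μ] 𝕜) ω * (v n : Ω →ₘ[μ] 𝕜) ω = 0) :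
    ∃ φ : ℕ → ℕ, StrictMono φ ∧ ∃ c : ℝ, 0 < c ∧ ∀ (s : Finset ℕ) (a : ℕ → 𝕜),
      c * ∑ k ∈ s, ‖a k‖ ≤ ‖∑ k ∈ s, a k • v (φ k)‖ := by
  have hpos : ∀ n, 0 < ‖v n‖ := fun n => hδ.trans_le (hv n)
  obtain ⟨φ, hφ, c, _, hc, _, h⟩ := hY (fun n => ((‖v n‖⁻¹ : ℝ) : 𝕜) • v n)
    (fun n => by
      rw [norm_smul, RCLike.norm_ofReal, abs_of_pos (inv_pos.2 (hpos n)),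
        inv_mul_cancel₀ (hpos n).ne'])
    (fun m n hmn => by
      filter_upwards [hd m n hmn, Y.coeFn_smul' ((‖v m‖⁻¹ : ℝ) : 𝕜) (v m),
        Y.coeFn_smul' ((‖v n‖⁻¹ : ℝ) : 𝕜) (v n)] with ω h1 h2 h3
      rw [h2, h3, mul_mul_mul_comm, h1, mul_zero])
  refine ⟨φ, hφ, c * δ, mul_pos hc hδ, fun s a => ?_⟩
  have h1 := (h s fun k => a k * ((‖v (φ k)‖ : ℝ) : 𝕜)).1
  have h2 : ∑ k ∈ s, (a k * ((‖v (φ k)‖ : ℝ) : 𝕜)) • ((‖v (φ k)‖⁻¹ : ℝ) : 𝕜) • v (φ k) =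
      ∑ k ∈ s, a k • v (φ k) := Finset.sum_congr rfl fun k _ => by
    rw [smul_smul, mul_assoc, ← RCLike.ofReal_mul, mul_inv_cancel₀ (hpos _).ne',
      RCLike.ofReal_one, mul_one]
  rw [h2] at h1
  refine le_trans ?_ h1
  rw [mul_assoc, Finset.mul_sum]
  refine mul_le_mul_of_nonneg_left (Finset.sum_le_sum fun k _ => ?_) hc.le
  rw [norm_mul, RCLike.norm_ofReal, _root_.abs_norm, mul_comm]
  exact mul_le_mul_of_nonneg_left (hv _) (norm_nonneg _)

theorem proj_mul_proj_eq_zero {σ τ : Set Ω} (hσ : MeasurableSet σ) (hτ : MeasurableSet τ)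
    (h : Disjoint σ τ) (f g : Y) :
    ∀ᵐ ω ∂μ, (Y.proj σ f : Ω →ₘ[μ] 𝕜) ω * (Y.proj τ g : Ω →ₘ[μ] 𝕜) ω = 0 := by
  filter_upwards [Y.coeFn_proj hσ f, Y.coeFn_proj hτ g] with ω h1 h2
  rw [h1, h2]
  by_cases hω : ω ∈ σ
  · simp [Set.disjoint_left.1 h hω]
  · simp [hω]

theorem IsOneDH.hasAbsContNorm (hY : Y.IsOneDH) (hF : Y.HasFatou) (y : Y) :
    Y.HasAbsContNorm y := by
  refine IdealSpace.hasAbsContNorm_of_tendsto_proj fun σ hσ ha h0 => ?_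
  have hanti : Antitone fun n => ‖Y.proj (σ n) y‖ :=
    fun m n hmn => Y.norm_proj_mono (hσ n) (hσ m) (ha hmn) y
  by_contra hnt
  obtain ⟨δ, hδ, hδn⟩ : ∃ δ > 0, ∀ n, δ ≤ ‖Y.proj (σ n) y‖ := by
    by_contra! hcon
    refine hnt (Metric.tendsto_atTop.2 fun ε hε => ?_)
    obtain ⟨N, hN⟩ := hcon ε hε
    refine ⟨N, fun n hn => ?_⟩
    rw [Real.dist_0_eq_abs, _root_.abs_norm]
    exact (hanti hn).trans_lt hN
  obtain ⟨κ, -, hκ⟩ := exists_seq_of_forall_finset_exists (fun _ : ℕ => True)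
    (fun j i => j < i ∧ δ / 2 ≤ ‖Y.proj (σ j \ σ i) y‖) (fun s _ => by
      have h1 : ∀ j ∈ s, ∀ᶠ i in atTop, j < i ∧ δ / 2 ≤ ‖Y.proj (σ j \ σ i) y‖ := by
        intro j _
        obtain ⟨i, hi⟩ : ∃ i, δ / 2 < ‖Y.proj (σ j \ σ i) y‖ := by
          by_contra! hcon
          have := hF.norm_proj_le hσ ha h0 (hσ j) y (half_pos hδ) hcon
          linarith [hδn j]
        filter_upwards [eventually_gt_atTop j, eventually_ge_atTop i] with k hk1 hk2
        exact ⟨hk1, hi.le.trans (Y.norm_proj_mono ((hσ j).diff (hσ i)) ((hσ j).diff (hσ k))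
          (Set.sdiff_subset_sdiff_right (ha hk2)) y)⟩
      obtain ⟨i, hi⟩ := ((Finset.eventually_all s).2 h1).exists
      exact ⟨i, trivial, hi⟩)
  have hκm : StrictMono κ := fun m n hmn => (hκ m n hmn).1
  set D : ℕ → Set Ω := fun i => σ (κ i) \ σ (κ (i + 1)) with hDdef
  have hD : ∀ i, MeasurableSet (D i) := fun i => (hσ _).diff (hσ _)
  have hd := ha.pairwise_disjoint_sdiff hκm
  obtain ⟨φ, hφ, c, hc, h⟩ := hY.exists_subseq_lower_l1 (v := fun i => Y.proj (D i) y)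
    (half_pos hδ) (fun i => (hκ i (i + 1) (Nat.lt_succ_self i)).2)
    (fun m n hmn => proj_mul_proj_eq_zero (hD m) (hD n) (hd hmn) y y)
  obtain ⟨N, hN⟩ := exists_nat_gt (‖y‖ / c)
  have h1 := h (Finset.range N) fun _ => 1
  simp only [norm_one, Finset.sum_const, Finset.card_range, nsmul_eq_mul, mul_one, one_smul] at h1
  rw [← Y.proj_biUnion (fun i => hD (φ i)) (fun i j hij => hd (hφ.injective.ne hij))] at h1
  have h2 := h1.trans (Y.norm_proj_le _ y)
  rw [div_lt_iff₀ hc] at hN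
  linarith

end KotheSpace

namespace KotheSpace

variable {𝕜 : Type*} [RCLike 𝕜] {Ω : Type*} [MeasurableSpace Ω] {μ : Measure Ω}
  {Y : KotheSpace 𝕜 μ}

theorem proj_iUnion_eq_sum_add {D : ℕ → Set Ω} (hD : ∀ n, MeasurableSet (D n))
    (hd : Pairwise fun i j => Disjoint (D i) (D j)) {κ : ℕ → ℕ} (hκ : StrictMono κ) (m : ℕ)
    (y : Y) : Y.proj (⋃ i, D (κ i)) y = ∑ i ∈ Finset.range m, Y.proj (D (κ i)) y +
      Y.proj ((⋃ i, D (κ i)) ∩ ⋃ j, ⋃ _ : κ m ≤ j, D j) y := by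
  have hE : MeasurableSet (⋃ i, D (κ i)) := MeasurableSet.iUnion fun i => hD _
  have hG : MeasurableSet (⋃ j, ⋃ _ : κ m ≤ j, D j) :=
    MeasurableSet.iUnion fun j => MeasurableSet.iUnion fun _ => hD j
  rw [← Y.proj_biUnion (fun i => hD (κ i)) (fun i j hij => hd (hκ.injective.ne hij)),
    ← Y.proj_union (Finset.measurableSet_biUnion _ fun i _ => hD _) (hE.inter hG)]
  · congr 1
    congr 1
    ext ω
    simp only [Set.mem_iUnion, Set.mem_union, Set.mem_inter_iff, Finset.mem_range]
    constructor
    · rintro ⟨i, hi⟩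
      by_cases him : i < m
      · exact Or.inl ⟨i, him, hi⟩
      · exact Or.inr ⟨⟨i, hi⟩, κ i, hκ.monotone (not_lt.1 him), hi⟩
    · rintro (⟨i, -, hi⟩ | ⟨h, -⟩)
      · exact ⟨i, hi⟩
      · exact h
  · rw [Set.disjoint_left]
    intro ω h1 h2
    simp only [Set.mem_iUnion, Set.mem_inter_iff, Finset.mem_range] at h1 h2
    obtain ⟨i, him, hi⟩ := h1
    obtain ⟨-, j, hj, hωj⟩ := h2
    exact Set.disjoint_left.1 (hd ((hκ him).trans_le hj).ne) hi hωj

theorem tendsto_norm_proj_tail {D : ℕ → Set Ω} (hD : ∀ n, MeasurableSet (D n))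
    (hd : Pairwise fun i j => Disjoint (D i) (D j)) {y : Y} (hy : Y.HasAbsContNorm y) :
    Tendsto (fun n => ‖Y.proj (⋃ j, ⋃ _ : n ≤ j, D j) y‖) atTop (𝓝 0) := by
  refine hy.tendsto_proj
    (fun n => MeasurableSet.iUnion fun j => MeasurableSet.iUnion fun _ => hD j) ?_ ?_
  · intro m n hmn ω hω
    simp only [Set.mem_iUnion] at hω ⊢
    obtain ⟨j, hj, h⟩ := hω
    exact ⟨j, hmn.trans hj, h⟩
  · convert measure_empty (μ := μ)
    rw [Set.eq_empty_iff_forall_notMem]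
    intro ω hω
    simp only [Set.mem_iInter, Set.mem_iUnion] at hω
    obtain ⟨j, -, hj⟩ := hω 0
    obtain ⟨k, hk, hk'⟩ := hω (j + 1)
    exact Set.disjoint_left.1 (hd (Nat.lt_of_succ_le hk).ne) hj hk'

/-- Gliding hump: a functional cannot stay bounded below on the pieces `χ_{D_k} y_k` of a
sequence all of whose subsequences have weak cluster points, the sets `D_k` being disjoint. -/
theorem not_le_re_dual_proj (hY : ∀ y : Y, Y.HasAbsContNorm y) {y : ℕ → Y}
    (hy : ∀ 𝒰 : Ultrafilter ℕ, ∃ z : Y, ∀ φ : StrongDual 𝕜 Y,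
      Tendsto (fun n => φ (y n)) (𝒰 : Filter ℕ) (𝓝 (φ z)))
    {D : ℕ → Set Ω} (hD : ∀ n, MeasurableSet (D n))
    (hd : Pairwise fun i j => Disjoint (D i) (D j)) (ψ : StrongDual 𝕜 Y) {u : ℝ} (hu : 0 < u) :
    ¬ ∀ k, u ≤ RCLike.re (ψ (Y.proj (D k) (y k))) := by
  intro hψ
  set 𝒰 : Ultrafilter ℕ := hyperfilter ℕ
  have h𝒰 : (𝒰 : Filter ℕ) ≤ atTop := Nat.hyperfilter_le_atTop
  obtain ⟨z, hz⟩ := hy 𝒰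
  set w : ℕ → Y := fun n => y n - z with hw
  set G : ℕ → Set Ω := fun n => ⋃ j, ⋃ _ : n ≤ j, D j with hG
  have hGm : ∀ n, MeasurableSet (G n) := fun n =>
    MeasurableSet.iUnion fun j => MeasurableSet.iUnion fun _ => hD j
  have htail : ∀ v : Y, Tendsto (fun n => ‖ψ‖ * ‖Y.proj (G n) v‖) atTop (𝓝 0) := fun v => by
    simpa using (tendsto_norm_proj_tail hD hd (hY v)).const_mul ‖ψ‖
  have hcoord : ∀ j, Tendsto (fun n => ‖ψ (Y.proj (D j) (w n))‖) (𝒰 : Filter ℕ) (𝓝 0) := by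
    intro j
    have h1 := (hz (ψ.comp (Y.proj (D j)))).sub_const ((ψ.comp (Y.proj (D j))) z)
    rw [sub_self] at h1
    refine tendsto_zero_iff_norm_tendsto_zero.1 (h1.congr fun n => ?_)
    rw [← map_sub]; rfl
  set η := u / 8 with hη
  have hη0 : 0 < η := by positivity
  obtain ⟨κ, hκP, hκ⟩ := exists_seq_of_forall_finset_exists
    (fun k : ℕ => ‖ψ (Y.proj (D k) z)‖ < η)
    (fun x k => x < k ∧ ‖ψ‖ * ‖Y.proj (G k) (w x)‖ < η ∧
      ∑ j ∈ Finset.range (x + 1), ‖ψ (Y.proj (D j) (w k))‖ < η / (x + 1)) (fun s _ => by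
      have h1 : ∀ x ∈ s, ∀ᶠ k in (𝒰 : Filter ℕ), x < k ∧ ‖ψ‖ * ‖Y.proj (G k) (w x)‖ < η ∧
          ∑ j ∈ Finset.range (x + 1), ‖ψ (Y.proj (D j) (w k))‖ < η / (x + 1) := by
        intro x _
        have h2 : Tendsto (fun k => ∑ j ∈ Finset.range (x + 1), ‖ψ (Y.proj (D j) (w k))‖)
            (𝒰 : Filter ℕ) (𝓝 0) := by
          simpa using tendsto_finsetSum (Finset.range (x + 1)) fun j _ => hcoord j
        filter_upwards [h𝒰 (eventually_gt_atTop x),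
          h𝒰 ((htail (w x)).eventually_lt_const hη0),
          h2.eventually_lt_const (show 0 < η / (x + 1) by positivity)] with k h1 h2 h3
        exact ⟨h1, h2, h3⟩
      have h2 : ∀ᶠ k in (𝒰 : Filter ℕ), ‖ψ (Y.proj (D k) z)‖ < η := by
        filter_upwards [h𝒰 ((htail z).eventually_lt_const hη0)] with k hk
        refine lt_of_le_of_lt ((ψ.le_opNorm _).trans ?_) hk
        refine mul_le_mul_of_nonneg_left ?_ (norm_nonneg _)
        exact Y.norm_proj_mono (hD k) (hGm k) (Set.subset_iUnion₂_of_subset k le_rfl subset_rfl) z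
      obtain ⟨k, hk⟩ := (h2.and ((Finset.eventually_all s).2 h1)).exists
      exact ⟨k, hk⟩)
  have hκm : StrictMono κ := fun m n hmn => (hκ m n hmn).1
  set E : Set Ω := ⋃ i, D (κ i) with hE
  have hEm : MeasurableSet E := MeasurableSet.iUnion fun i => hD _
  have hrest : ∀ (n : ℕ) (v : Y), ‖ψ (Y.proj (E ∩ G n) v)‖ ≤ ‖ψ‖ * ‖Y.proj (G n) v‖ := fun n v =>
    (ψ.le_opNorm _).trans <| mul_le_mul_of_nonneg_left
      (Y.norm_proj_mono (hEm.inter (hGm n)) (hGm n) Set.inter_subset_right v) (norm_nonneg _)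
  have hlow : ∀ m, u / 2 ≤ RCLike.re (ψ (Y.proj E (w (κ m)))) := by
    intro m
    have h1 := congrArg (fun v => RCLike.re (ψ v))
      (proj_iUnion_eq_sum_add hD hd hκm (m + 1) (w (κ m)))
    simp only [Finset.sum_range_succ, map_add] at h1
    have h2 : u - η ≤ RCLike.re (ψ (Y.proj (D (κ m)) (w (κ m)))) := by
      simp only [hw, map_sub]
      linarith [hψ (κ m), hκP m, RCLike.re_le_norm (ψ (Y.proj (D (κ m)) z)), hψ (κ m)]
    have h3 : ‖ψ (Y.proj (E ∩ G (κ (m + 1))) (w (κ m)))‖ ≤ η :=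
      (hrest _ _).trans (hκ m (m + 1) (Nat.lt_succ_self m)).2.1.le
    have h4 : ‖ψ (∑ i ∈ Finset.range m, Y.proj (D (κ i)) (w (κ m)))‖ ≤ η := by
      rw [map_sum]
      refine (norm_sum_le _ _).trans ?_
      cases m with
      | zero => simpa using hη0.le
      | succ m =>
        have h5 := (hκ m (m + 1) (Nat.lt_succ_self m)).2.2.le
        have h6 : η / (κ m + 1) ≤ η :=
          div_le_self hη0.le (by linarith [(Nat.cast_nonneg (κ m) : (0 : ℝ) ≤ κ m)])
        refine le_trans ?_ (h5.trans h6)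
        rw [← Finset.sum_image (g := κ)
          (f := fun j => ‖ψ (Y.proj (D j) (w (κ (m + 1))))‖) (fun i _ j _ h => hκm.injective h)]
        refine Finset.sum_le_sum_of_subset_of_nonneg ?_ fun _ _ _ => norm_nonneg _
        intro j hj
        obtain ⟨i, hi, rfl⟩ := Finset.mem_image.1 hj
        exact Finset.mem_range.2 (Nat.lt_succ_of_le
          (hκm.monotone (Nat.lt_succ_iff.1 (Finset.mem_range.1 hi))))
    have h7 := (abs_le.1 ((RCLike.abs_re_le_norm _).trans h3)).1
    have h8 := (abs_le.1 ((RCLike.abs_re_le_norm _).trans h4)).1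
    rw [h1]
    linarith
  obtain ⟨z', hz'⟩ := hy (𝒰.map κ)
  have hlim : ∀ φ : StrongDual 𝕜 Y, Tendsto (fun m => φ (w (κ m))) (𝒰 : Filter ℕ)
      (𝓝 (φ (z' - z))) := by
    intro φ
    have h1 : Tendsto (fun m => φ (y (κ m))) (𝒰 : Filter ℕ) (𝓝 (φ z')) := hz' φ
    simpa only [hw, map_sub] using h1.sub_const (φ z)
  have hcoord0 : ∀ j, ψ (Y.proj (D j) (z' - z)) = 0 := by
    intro j
    refine tendsto_nhds_unique (hlim (ψ.comp (Y.proj (D j)))) ?_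
    refine tendsto_zero_iff_norm_tendsto_zero.2 ?_
    rw [Metric.tendsto_nhds]
    intro ε hε
    have h1 : Tendsto (fun n : ℕ => η / ((κ n : ℝ) + 1)) atTop (𝓝 0) :=
      Tendsto.const_div_atTop (tendsto_atTop_add_const_right _ _
        (tendsto_natCast_atTop_atTop.comp hκm.tendsto_atTop)) _
    obtain ⟨n, hn1, hn2⟩ := ((h1.eventually_lt_const hε).and (eventually_ge_atTop j)).exists
    filter_upwards [h𝒰 (eventually_gt_atTop n)] with m hm
    rw [Real.dist_0_eq_abs, _root_.abs_norm]
    refine lt_of_le_of_lt ?_ ((hκ n m hm).2.2.trans hn1)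
    exact Finset.single_le_sum (f := fun j => ‖ψ (Y.proj (D j) (w (κ m)))‖)
      (fun _ _ => norm_nonneg _)
      (Finset.mem_range.2 (Nat.lt_succ_of_le (hn2.trans (hκm.le_apply))))
  have hzero : ψ (Y.proj E (z' - z)) = 0 := by
    have h1 : ∀ m, ‖ψ (Y.proj E (z' - z))‖ ≤ ‖ψ‖ * ‖Y.proj (G (κ m)) (z' - z)‖ := by
      intro m
      refine le_trans (le_of_eq ?_) (hrest (κ m) (z' - z))
      rw [hE, proj_iUnion_eq_sum_add hD hd hκm m, map_add, map_sum,
        Finset.sum_eq_zero fun i _ => hcoord0 (κ i), zero_add]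
    exact norm_le_zero_iff.1 (ge_of_tendsto' ((htail _).comp hκm.tendsto_atTop) h1)
  have h2 : Tendsto (fun m => RCLike.re (ψ (Y.proj E (w (κ m))))) (𝒰 : Filter ℕ)
      (𝓝 (RCLike.re (ψ (Y.proj E (z' - z))))) :=
    (RCLike.continuous_re.tendsto _).comp (hlim (ψ.comp (Y.proj E)))
  have h3 := ge_of_tendsto' h2 hlow
  rw [hzero, map_zero] at h3
  linarith

theorem IsOneDH.exists_norm_proj_lt (hY : Y.IsOneDH) (hF : Y.HasFatou) {y : ℕ → Y}
    (hy : ∀ 𝒰 : Ultrafilter ℕ, ∃ z : Y, ∀ φ : StrongDual 𝕜 Y,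
      Tendsto (fun n => φ (y n)) (𝒰 : Filter ℕ) (𝓝 (φ z)))
    {D : ℕ → Set Ω} (hD : ∀ n, MeasurableSet (D n))
    (hd : Pairwise fun i j => Disjoint (D i) (D j)) {δ : ℝ} (hδ : 0 < δ) :
    ∃ k, ‖Y.proj (D k) (y k)‖ < δ := by
  by_contra! hcon
  obtain ⟨φ, hφ, c, hc, h⟩ := hY.exists_subseq_lower_l1 (v := fun k => Y.proj (D k) (y k)) hδ hcon
    fun m n hmn => proj_mul_proj_eq_zero (hD m) (hD n) (hd hmn) _ _
  obtain ⟨ψ, u, hu, hψ⟩ := exists_dual_le_re_of_lower_l1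
    (fun k => Y.proj (D (φ k)) (y (φ k))) hc h
  exact not_le_re_dual_proj (hY.hasAbsContNorm hF) (y := y ∘ φ) (D := D ∘ φ)
    (fun 𝒰 => hy (𝒰.map φ)) (fun n => hD _) (fun i j hij => hd (hφ.injective.ne hij)) ψ hu hψ

end KotheSpace

namespace IdealSpace

variable {𝕜 : Type*} [RCLike 𝕜] {Ω : Type*} [MeasurableSpace Ω] {μ : Measure Ω}

/-- If the simple functions of `X` have absolutely continuous norms, every element of `X` has an
absolutely continuous norm off arbitrarily small sets. -/
theorem exists_seq_hasAbsContNorm_proj [SigmaFinite μ] (X : IdealSpace 𝕜 μ)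
    (h : ∀ f : X, (f : Ω →ₘ[μ] 𝕜) ∈ simpleFunctions 𝕜 μ → X.HasAbsContNorm f) (l : X) :
    ∃ A : ℕ → Set Ω, (∀ n, MeasurableSet (A n)) ∧ Monotone A ∧ ⋃ n, A n = Set.univ ∧
      ∀ n, X.HasAbsContNorm (X.proj (A n) l) := by
  have hlm : Measurable fun ω => ‖(l : Ω →ₘ[μ] 𝕜) ω‖ := (AEEqFun.measurable _).norm
  set B : ℕ → Set Ω := fun n =>
    ({ω | 1 ≤ ((n : ℝ) + 1) * ‖(l : Ω →ₘ[μ] 𝕜) ω‖} ∩ {ω | ‖(l : Ω →ₘ[μ] 𝕜) ω‖ ≤ (n : ℝ) + 1}) ∩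
      spanningSets μ n with hB
  set Z : Set Ω := {ω | ‖(l : Ω →ₘ[μ] 𝕜) ω‖ = 0} with hZ
  have hBm : ∀ n, MeasurableSet (B n) := fun n =>
    ((measurableSet_le measurable_const (hlm.const_mul _)).inter
      (measurableSet_le hlm measurable_const)).inter (measurableSet_spanningSets μ n)
  have hZm : MeasurableSet Z := measurableSet_eq_fun hlm measurable_const
  refine ⟨fun n => B n ∪ Z, fun n => (hBm n).union hZm, ?_, ?_, fun n => ?_⟩
  · intro m n hmn
    refine Set.union_subset_union_left _ ?_
    rintro ω ⟨⟨h1, h2⟩, h3⟩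
    have : (m : ℝ) ≤ n := Nat.cast_le.2 hmn
    have h1' : 1 ≤ ((m : ℝ) + 1) * ‖(l : Ω →ₘ[μ] 𝕜) ω‖ := h1
    have h2' : ‖(l : Ω →ₘ[μ] 𝕜) ω‖ ≤ (m : ℝ) + 1 := h2
    exact ⟨⟨h1'.trans (by gcongr), h2'.trans (by gcongr)⟩, monotone_spanningSets μ hmn h3⟩
  · refine Set.eq_univ_of_forall fun ω => Set.mem_iUnion.2 ?_
    by_cases h0 : ‖(l : Ω →ₘ[μ] 𝕜) ω‖ = 0
    · exact ⟨0, Or.inr h0⟩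
    · have hpos : 0 < ‖(l : Ω →ₘ[μ] 𝕜) ω‖ := lt_of_le_of_ne (norm_nonneg _) (Ne.symm h0)
      have hs : ω ∈ ⋃ n, spanningSets μ n := by rw [iUnion_spanningSets]; trivial
      obtain ⟨n₁, h1⟩ := Set.mem_iUnion.1 hs
      obtain ⟨n₂, h2⟩ := exists_nat_ge ‖(l : Ω →ₘ[μ] 𝕜) ω‖
      obtain ⟨n₃, h3⟩ := exists_nat_ge (1 / ‖(l : Ω →ₘ[μ] 𝕜) ω‖)
      rw [div_le_iff₀ hpos] at h3
      have h2' : (n₂ : ℝ) ≤ (max n₁ (max n₂ n₃) : ℕ) := Nat.cast_le.2 (by simp)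
      have h3' : (n₃ : ℝ) ≤ (max n₁ (max n₂ n₃) : ℕ) := Nat.cast_le.2 (by simp)
      refine ⟨max n₁ (max n₂ n₃), Or.inl ⟨⟨?_, ?_⟩, monotone_spanningSets μ (le_max_left _ _) h1⟩⟩
      · refine h3.trans ?_
        have : (n₃ : ℝ) ≤ (max n₁ (max n₂ n₃) : ℕ) + 1 := by linarith
        gcongr
      · exact h2.trans (by linarith)
  · have hfin : μ (B n) < ⊤ :=
      (measure_mono Set.inter_subset_right).trans_lt (measure_spanningSets_lt_top μ n)
    obtain ⟨e, he⟩ := X.exists_coeFn_eq_of_ae_le (F := (B n).indicator fun _ => (1 : 𝕜))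
      (aestronglyMeasurable_const.indicator (hBm n)) ((((n : ℝ) + 1 : ℝ) : 𝕜) • l) (by
        filter_upwards [X.coeFn_smul' (((n : ℝ) + 1 : ℝ) : 𝕜) l] with ω h1
        rw [h1, norm_mul, RCLike.norm_ofReal, abs_of_pos (by positivity)]
        by_cases hω : ω ∈ B n
        · rw [Set.indicator_of_mem hω, norm_one]
          exact hω.1.1
        · rw [Set.indicator_of_notMem hω, norm_zero]
          positivity)
    have hes : (e : Ω →ₘ[μ] 𝕜) = _root_.charFun 𝕜 μ (B n) (hBm n) :=
      AEEqFun.ext (he.trans (AEEqFun.coeFn_mk _ _).symm)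
    refine (h e (Submodule.subset_span ⟨B n, hBm n, hfin, hes⟩)).of_ae_le (C := (n : ℝ) + 1) ?_
    filter_upwards [he, X.coeFn_proj ((hBm n).union hZm) l] with ω h1 h2
    rw [h1, h2]
    by_cases hω : ω ∈ B n
    · rw [Set.indicator_of_mem hω, Set.indicator_of_mem (Set.mem_union_left Z hω), norm_one, mul_one]
      exact hω.1.2
    · rw [Set.indicator_of_notMem hω, norm_zero, mul_zero]
      by_cases hω' : ω ∈ Z
      · rw [Set.indicator_of_mem (Set.mem_union_right (B n) hω')]
        exact le_of_eq hω'
      · rw [Set.indicator_of_notMem (fun h => h.elim hω hω'), norm_zero]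

end IdealSpace

namespace KotheSpace

variable {𝕜 : Type*} [RCLike 𝕜] {Ω : Type*} [MeasurableSpace Ω] {μ : Measure Ω}
  (X Y : KotheSpace 𝕜 μ)

theorem exists_tendsto_dual_of_mem_weaklyCompactOps {W : X →L[𝕜] Y} (hW : W ∈ weaklyCompactOps X Y)
    {f : ℕ → X} (hf : ∀ n, ‖f n‖ ≤ 1) (𝒰 : Ultrafilter ℕ) :
    ∃ z : Y, ∀ φ : StrongDual 𝕜 Y,
      Tendsto (fun n => φ (W (f n))) (𝒰 : Filter ℕ) (𝓝 (φ z)) := by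
  have hcpt := hW (Metric.closedBall 0 1) Metric.isBounded_closedBall
  obtain ⟨z, -, hz⟩ := hcpt.ultrafilter_le_nhds' (𝒰.map fun n => toWeakSpace 𝕜 Y (W (f n))) (by
    rw [Ultrafilter.mem_map]
    exact univ_mem' fun n => subset_closure ⟨_, ⟨f n, by simpa using hf n, rfl⟩, rfl⟩)
  have hz : Tendsto (fun n => toWeakSpace 𝕜 Y (W (f n))) (𝒰 : Filter ℕ) (𝓝 z) := hz
  refine ⟨(toWeakSpace 𝕜 Y).symm z, fun φ => ?_⟩
  exact ((WeakBilin.eval_continuous (topDualPairing 𝕜 Y).flip φ).tendsto z).comp hz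

variable [SigmaFinite μ] (l : multipliers X Y)

theorem infDist_ocPart_le_dist_of_mem_weaklyCompactOps (hY : Y.HasFatou) (hDH : Y.IsOneDH)
    (h : ∀ f : multipliers X Y, (f : Ω →ₘ[μ] 𝕜) ∈ simpleFunctions 𝕜 μ →
      (multipliers X Y).HasAbsContNorm f) {W : X →L[𝕜] Y} (hW : W ∈ weaklyCompactOps X Y) :
    Metric.infDist l (multipliers X Y).ocPart ≤ dist (mulOp X Y l) W := by
  by_contra! hlt
  obtain ⟨r, hr1, hr2⟩ := exists_between hlt
  obtain ⟨A, hA, hAmono, hAun, hAC⟩ := (multipliers X Y).exists_seq_hasAbsContNorm_proj h l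
  choose f hf1 hf2 hf3 using fun n => exists_lt_norm_mulOp_of_proj_mem_ocPart X Y l (hA n)
    (IdealSpace.mem_ocPart_iff.2 (hAC n)) hr2
  set σ : ℕ → Set Ω := fun n => (A n)ᶜ with hσdef
  have hσ : ∀ n, MeasurableSet (σ n) := fun n => (hA n).compl
  have ha : Antitone σ := fun m n hmn => Set.compl_subset_compl.2 (hAmono hmn)
  have h0 : μ (⋂ n, σ n) = 0 := by
    rw [hσdef, ← Set.compl_iUnion, hAun, Set.compl_univ, measure_empty]
  set ε := (r - dist (mulOp X Y l) W) / 2 with hε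
  have hε0 : 0 < ε := by rw [hε]; linarith
  obtain ⟨κ, -, hκ⟩ := exists_seq_of_forall_finset_exists (fun _ : ℕ => True)
    (fun k i => k < i ∧ ‖Y.proj (σ i) (mulOp X Y l (f k))‖ < ε) (fun s _ => by
      have h1 : ∀ k ∈ s, ∀ᶠ i in atTop, k < i ∧ ‖Y.proj (σ i) (mulOp X Y l (f k))‖ < ε :=
        fun k _ => (eventually_gt_atTop k).and
          (((hDH.hasAbsContNorm hY _).tendsto_proj hσ ha h0).eventually_lt_const hε0)
      obtain ⟨i, hi⟩ := ((Finset.eventually_all s).2 h1).exists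
      exact ⟨i, trivial, hi⟩)
  have hκm : StrictMono κ := fun m n hmn => (hκ m n hmn).1
  obtain ⟨k, hk⟩ := hDH.exists_norm_proj_lt hY (y := fun m => W (f (κ m)))
    (D := fun i => σ (κ i) \ σ (κ (i + 1)))
    (fun 𝒰 => exists_tendsto_dual_of_mem_weaklyCompactOps X Y hW (fun n => hf1 (κ n)) 𝒰)
    (fun i => (hσ _).diff (hσ _)) (ha.pairwise_disjoint_sdiff hκm) hε0
  set D := σ (κ k) \ σ (κ (k + 1)) with hD
  have hDm : MeasurableSet D := (hσ _).diff (hσ _)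
  have h1 : mulOp X Y l (f (κ k)) = Y.proj D (mulOp X Y l (f (κ k))) +
      Y.proj (σ (κ (k + 1))) (mulOp X Y l (f (κ k))) := by
    rw [← Y.proj_union hDm (hσ _) Set.disjoint_sdiff_left, hD,
      Set.sdiff_union_of_subset (ha (hκm (Nat.lt_succ_self k)).le), proj_mulOp X Y l (hσ _), hf2]
  have h2 : Y.proj D (mulOp X Y l (f (κ k))) =
      Y.proj D ((mulOp X Y l - W) (f (κ k))) + Y.proj D (W (f (κ k))) := by
    rw [← map_add, sub_apply, sub_add_cancel]
  have h3 : ‖Y.proj D ((mulOp X Y l - W) (f (κ k)))‖ ≤ dist (mulOp X Y l) W := by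
    rw [dist_eq_norm]
    exact (Y.norm_proj_le _ _).trans ((mulOp X Y l - W).unit_le_opNorm _ (hf1 _))
  have h4 := (hκ k (k + 1) (Nat.lt_succ_self k)).2
  have h5 := hf3 (κ k)
  rw [h1] at h5
  have h6 := norm_add_le (Y.proj D (mulOp X Y l (f (κ k))))
    (Y.proj (σ (κ (k + 1))) (mulOp X Y l (f (κ k))))
  have h7 := norm_add_le (Y.proj D ((mulOp X Y l - W) (f (κ k)))) (Y.proj D (W (f (κ k))))
  rw [← h2] at h7
  linarith

end KotheSpace

section WeakTopology

variable {𝕜 E ι : Type*} [RCLike 𝕜] [NormedAddCommGroup E] [NormedSpace 𝕜 E]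

theorem isCompact_closure_toWeakSpace_image {S : Set E} (hS : Bornology.IsBounded S)
    (h : ∀ 𝒰 : Ultrafilter E, S ∈ 𝒰 → ∃ z : E, ∀ φ : StrongDual 𝕜 E,
      Tendsto (fun x => φ x) (𝒰 : Filter E) (𝓝 (φ z))) :
    IsCompact (closure (toWeakSpace 𝕜 E '' S)) := by
  refine NormedSpace.isCompact_closure_of_isBounded 𝕜 E _ ?_ ?_
  · rwa [Set.preimage_image_eq _ (toWeakSpace 𝕜 E).injective]
  · intro L hL
    rw [Set.image_image, mem_closure_iff_clusterPt, ClusterPt, ← map_principal, inf_comm,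
      ← neBot_inf_comap_iff_map] at hL
    set 𝒰 := Ultrafilter.of (𝓟 S ⊓ comap
      (fun x => NormedSpace.inclusionInDoubleDualWeak 𝕜 E (toWeakSpace 𝕜 E x)) (𝓝 L)) with h𝒰
    have hle := Ultrafilter.of_le (𝓟 S ⊓ comap
      (fun x => NormedSpace.inclusionInDoubleDualWeak 𝕜 E (toWeakSpace 𝕜 E x)) (𝓝 L))
    obtain ⟨z, hz⟩ := h 𝒰 (le_principal_iff.1 (hle.trans inf_le_left))
    refine ⟨toWeakSpace 𝕜 E z, ?_⟩
    have hL' : Tendsto (fun x => NormedSpace.inclusionInDoubleDualWeak 𝕜 E (toWeakSpace 𝕜 E x))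
        (𝒰 : Filter E) (𝓝 L) := tendsto_iff_comap.2 (hle.trans inf_le_right)
    refine DFunLike.ext _ _ fun φ => tendsto_nhds_unique (hz φ) ?_
    exact ((WeakDual.eval_continuous φ).tendsto L).comp hL'

/-- Weak limits along an ultrafilter exist if they exist up to arbitrarily small errors. -/
theorem exists_tendsto_dual_of_approx [CompleteSpace E] (𝒰 : Ultrafilter ι) {y : ι → E} {R : ℝ}
    (hy : ∀ᶠ i in (𝒰 : Filter ι), ‖y i‖ ≤ R)
    (h : ∀ ε > 0, ∃ (y' : ι → E) (z : E), (∀ᶠ i in (𝒰 : Filter ι), ‖y i - y' i‖ ≤ ε) ∧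
      ∀ φ : StrongDual 𝕜 E, Tendsto (fun i => φ (y' i)) (𝒰 : Filter ι) (𝓝 (φ z))) :
    ∃ z : E, ∀ φ : StrongDual 𝕜 E, Tendsto (fun i => φ (y i)) (𝒰 : Filter ι) (𝓝 (φ z)) := by
  obtain ⟨L, -, hL⟩ := exists_tendsto_bidual_of_norm_le (𝕜 := 𝕜) 𝒰 y hy
  have happ : ∀ n : ℕ, ∃ z : E, ∀ φ : StrongDual 𝕜 E, ‖L φ - φ z‖ ≤ 1 / ((n : ℝ) + 1) * ‖φ‖ := by
    intro n
    obtain ⟨y', z, h1, h2⟩ := h (1 / ((n : ℝ) + 1)) Nat.one_div_pos_of_nat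
    refine ⟨z, fun φ => le_of_tendsto ((hL φ).sub (h2 φ)).norm ?_⟩
    filter_upwards [h1] with i hi
    rw [← map_sub, mul_comm]
    exact (φ.le_opNorm _).trans (mul_le_mul_of_nonneg_left hi (norm_nonneg _))
  choose v hv using happ
  have hvc : CauchySeq v := by
    refine cauchySeq_of_le_tendsto_0' (fun n : ℕ => 2 * (1 / ((n : ℝ) + 1))) (fun n m hnm => ?_)
      (by simpa using tendsto_one_div_add_atTop_nhds_zero_nat.const_mul (2 : ℝ))
    rw [dist_eq_norm]
    refine NormedSpace.norm_le_dual_bound 𝕜 _ (by positivity) fun φ => ?_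
    have h1 : φ (v n - v m) = (L φ - φ (v m)) - (L φ - φ (v n)) := by rw [map_sub]; ring
    have h2 : 1 / ((m : ℝ) + 1) * ‖φ‖ ≤ 1 / ((n : ℝ) + 1) * ‖φ‖ :=
      mul_le_mul_of_nonneg_right (Nat.one_div_le_one_div hnm) (norm_nonneg _)
    rw [h1]
    linarith [norm_sub_le (L φ - φ (v m)) (L φ - φ (v n)), hv n φ, hv m φ]
  obtain ⟨z, hz⟩ := cauchySeq_tendsto_of_complete hvc
  refine ⟨z, fun φ => ?_⟩
  have h1 : Tendsto (fun n => L φ - φ (v n)) atTop (𝓝 0) := squeeze_zero_norm (fun n => hv n φ)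
    (by simpa using tendsto_one_div_add_atTop_nhds_zero_nat.mul_const ‖φ‖)
  have h2 := tendsto_nhds_unique h1 (((φ.continuous.tendsto z).comp hz).const_sub (L φ))
  rw [← sub_eq_zero.1 h2.symm]
  exact hL φ

theorem mem_of_tendsto_dual [NormedSpace ℝ E] [IsScalarTower ℝ 𝕜 E] {s : Set E} (hs : Convex ℝ s)
    (hc : IsClosed s) {l : Filter ι} [l.NeBot] {y : ι → E} {z : E} (hy : ∀ᶠ i in l, y i ∈ s)
    (hz : ∀ φ : StrongDual 𝕜 E, Tendsto (fun i => φ (y i)) l (𝓝 (φ z))) : z ∈ s := by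
  by_contra hzs
  obtain ⟨φ, u, h1, h2⟩ := RCLike.geometric_hahn_banach_closed_point (𝕜 := 𝕜) hs hc hzs
  refine h2.not_ge (le_of_tendsto ((RCLike.continuous_re.tendsto _).comp (hz φ)) ?_)
  filter_upwards [hy] with i hi using (h1 _ hi).le

theorem exists_tendsto_dual_of_norm_le_of_innerProductSpace {H : Type*} [NormedAddCommGroup H]
    [InnerProductSpace 𝕜 H] [CompleteSpace H] (𝒰 : Ultrafilter ι) {y : ι → H} {R : ℝ}
    (hy : ∀ i, ‖y i‖ ≤ R) :
    ∃ z : H, ∀ φ : StrongDual 𝕜 H, Tendsto (fun i => φ (y i)) (𝒰 : Filter ι) (𝓝 (φ z)) := by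
  obtain ⟨L, -, hL⟩ := exists_tendsto_strongDual_of_norm_le (𝕜 := 𝕜) 𝒰
    (fun i => InnerProductSpace.toDual 𝕜 H (y i)) (R := R) (Eventually.of_forall fun i => by
      rw [LinearIsometryEquiv.norm_map]; exact hy i)
  obtain ⟨z, rfl⟩ := (InnerProductSpace.toDual 𝕜 H).surjective L
  refine ⟨z, fun φ => ?_⟩
  obtain ⟨v, rfl⟩ := (InnerProductSpace.toDual 𝕜 H).surjective φ
  have := (RCLike.continuous_conj.tendsto _).comp (hL v)
  simpa [Function.comp_def, InnerProductSpace.toDual_apply_apply] using this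

end WeakTopology

namespace IdealSpace

variable {𝕜 : Type*} [RCLike 𝕜] {Ω : Type*} [MeasurableSpace Ω] {μ : Measure Ω}

theorem convex_setOf_exists_mul {ν : Measure Ω} (hν : ae ν = ae μ) (Y : IdealSpace 𝕜 μ) (w : Y)
    (φ : StrongDual 𝕜 Y) (a : ℝ) :
    Convex ℝ {G : Lp 𝕜 2 ν | (∀ᵐ ω ∂μ, ‖G ω‖ ≤ 1) ∧ ∃ y : Y,
      (∀ᵐ ω ∂μ, (y : Ω →ₘ[μ] 𝕜) ω = (w : Ω →ₘ[μ] 𝕜) ω * G ω) ∧ RCLike.re (φ y) ≤ a} := by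
  rintro G₁ ⟨h1, y₁, hy₁, ha₁⟩ G₂ ⟨h2, y₂, hy₂, ha₂⟩ s t hs ht hst
  have hadd := Lp.coeFn_add (s • G₁) (t • G₂)
  have hs₁ := Lp.coeFn_smul s G₁
  have ht₂ := Lp.coeFn_smul t G₂
  rw [EventuallyEq, hν] at hadd hs₁ ht₂
  have hG : ∀ᵐ ω ∂μ, (s • G₁ + t • G₂ : Lp 𝕜 2 ν) ω = (s : 𝕜) * G₁ ω + (t : 𝕜) * G₂ ω := by
    filter_upwards [hadd, hs₁, ht₂] with ω a1 a2 a3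
    rw [a1, Pi.add_apply, a2, a3, Pi.smul_apply, Pi.smul_apply, RCLike.real_smul_eq_coe_mul,
      RCLike.real_smul_eq_coe_mul]
  refine ⟨?_, (s : 𝕜) • y₁ + (t : 𝕜) • y₂, ?_, ?_⟩
  · filter_upwards [hG, h1, h2] with ω a1 a2 a3
    rw [a1]
    refine (norm_add_le _ _).trans ?_
    rw [norm_mul, norm_mul, RCLike.norm_ofReal, RCLike.norm_ofReal, abs_of_nonneg hs,
      abs_of_nonneg ht, ← hst]
    exact add_le_add (mul_le_of_le_one_right hs a2) (mul_le_of_le_one_right ht a3)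
  · filter_upwards [hG, hy₁, hy₂, Y.coeFn_add' ((s : 𝕜) • y₁) ((t : 𝕜) • y₂),
      Y.coeFn_smul' (s : 𝕜) y₁, Y.coeFn_smul' (t : 𝕜) y₂] with ω a1 a2 a3 a4 a5 a6
    rw [a4, a5, a6, a1, a2, a3]
    ring
  · rw [map_add, map_smul, map_smul, map_add, smul_eq_mul, smul_eq_mul, RCLike.re_ofReal_mul,
      RCLike.re_ofReal_mul]
    calc _ ≤ s * a + t * a := by gcongr
      _ = a := by rw [← add_mul, hst, one_mul]

theorem isClosed_setOf_exists_mul {ν : Measure Ω} (hν : ae ν = ae μ) (Y : IdealSpace 𝕜 μ) {w : Y}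
    (hw : Y.HasAbsContNorm w) (φ : StrongDual 𝕜 Y) (a : ℝ) :
    IsClosed {G : Lp 𝕜 2 ν | (∀ᵐ ω ∂μ, ‖G ω‖ ≤ 1) ∧ ∃ y : Y,
      (∀ᵐ ω ∂μ, (y : Ω →ₘ[μ] 𝕜) ω = (w : Ω →ₘ[μ] 𝕜) ω * G ω) ∧ RCLike.re (φ y) ≤ a} := by
  refine IsSeqClosed.isClosed fun u G hu hG => ?_
  obtain ⟨ns, -, hns⟩ := (tendstoInMeasure_of_tendsto_Lp hG).exists_seq_tendsto_ae
  rw [hν] at hns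
  choose hu1 y hy hya using hu
  have hG1 : ∀ᵐ ω ∂μ, ‖G ω‖ ≤ 1 := by
    filter_upwards [hns, ae_all_iff.2 hu1] with ω h1 h2
    exact le_of_tendsto' h1.norm fun k => h2 _
  have hGm : AEStronglyMeasurable G μ :=
    (Lp.aestronglyMeasurable G).mono_ac (Measure.ae_le_iff_absolutelyContinuous.1 hν.ge)
  obtain ⟨z, hz⟩ := Y.exists_coeFn_eq_of_ae_le (F := fun ω => (w : Ω →ₘ[μ] 𝕜) ω * G ω)
    ((AEEqFun.aestronglyMeasurable _).mul hGm) w (by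
      filter_upwards [hG1] with ω h1
      rw [norm_mul]
      exact mul_le_of_le_one_right (norm_nonneg _) h1)
  refine ⟨hG1, z, hz, ?_⟩
  have hlim : Tendsto (fun k => y (ns k)) atTop (𝓝 z) := by
    rw [tendsto_iff_norm_sub_tendsto_zero]
    refine hw.tendsto_norm_of_dominated (C := 2) zero_le_two ?_
    filter_upwards [hns, ae_all_iff.2 hu1, ae_all_iff.2 hy, hz, hG1,
      ae_all_iff.2 fun k => Y.coeFn_sub' (y (ns k)) z] with ω h1 h2 h3 h4 h5 h6
    simp only [h6, h3, h4, ← mul_sub, norm_mul]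
    refine ⟨fun k => ?_, ?_⟩
    · rw [mul_comm]
      refine mul_le_mul_of_nonneg_right ?_ (norm_nonneg _)
      calc _ ≤ _ := norm_sub_le _ _
        _ ≤ 1 + 1 := add_le_add (h2 _) h5
        _ = 2 := one_add_one_eq_two
    · simpa using (tendsto_iff_norm_sub_tendsto_zero.1 h1).const_mul ‖(w : Ω →ₘ[μ] 𝕜) ω‖
  exact le_of_tendsto' ((RCLike.continuous_re.tendsto _).comp ((φ.continuous.tendsto z).comp hlim))
    fun k => hya _

/-- Order intervals around elements with absolutely continuous norm are weakly compact. -/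
theorem HasAbsContNorm.exists_tendsto_dual [SigmaFinite μ] {Y : IdealSpace 𝕜 μ} {w : Y}
    (hw : Y.HasAbsContNorm w) {ι : Type*} (𝒰 : Ultrafilter ι) {g : ι → Ω → 𝕜}
    (hg : ∀ i, Measurable (g i)) (hg1 : ∀ i ω, ‖g i ω‖ ≤ 1) {y : ι → Y}
    (hy : ∀ i, ∀ᵐ ω ∂μ, (y i : Ω →ₘ[μ] 𝕜) ω = (w : Ω →ₘ[μ] 𝕜) ω * g i ω) :
    ∃ z : Y, ∀ φ : StrongDual 𝕜 Y, Tendsto (fun i => φ (y i)) (𝒰 : Filter ι) (𝓝 (φ z)) := by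
  set ν := μ.toFinite
  have hν : ae ν = ae μ := ae_toFinite
  have hL : ∀ i, MemLp (g i) 2 ν := fun i =>
    MemLp.of_bound (hg i).aestronglyMeasurable 1 (Eventually.of_forall (hg1 i))
  have hGg : ∀ i, ∀ᵐ ω ∂μ, (hL i).toLp (g i) ω = g i ω := fun i => by
    have := (hL i).coeFn_toLp
    rwa [EventuallyEq, hν] at this
  obtain ⟨G, hG⟩ := exists_tendsto_dual_of_norm_le_of_innerProductSpace (𝕜 := 𝕜) 𝒰
    (y := fun i => (hL i).toLp (g i)) (fun i => Lp.norm_le_of_ae_bound zero_le_one (by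
      filter_upwards [(hL i).coeFn_toLp] with ω hω
      rw [hω]; exact hg1 i ω))
  have hyb : ∀ i, ‖y i‖ ≤ ‖w‖ := fun i => Y.norm_le_of_ae_le _ _ (by
    filter_upwards [hy i] with ω h1
    rw [h1, norm_mul]
    exact mul_le_of_le_one_right (norm_nonneg _) (hg1 i ω))
  obtain ⟨L, -, hLim⟩ := exists_tendsto_bidual_of_norm_le (𝕜 := 𝕜) 𝒰 y (Eventually.of_forall hyb)
  have key : ∀ (φ : StrongDual 𝕜 Y) (a : ℝ), RCLike.re (L φ) < a →
      (∀ᵐ ω ∂μ, ‖G ω‖ ≤ 1) ∧ ∃ z : Y,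
      (∀ᵐ ω ∂μ, (z : Ω →ₘ[μ] 𝕜) ω = (w : Ω →ₘ[μ] 𝕜) ω * G ω) ∧ RCLike.re (φ z) ≤ a := by
    intro φ a ha
    refine mem_of_tendsto_dual (𝕜 := 𝕜) (Y.convex_setOf_exists_mul hν w φ a)
      (Y.isClosed_setOf_exists_mul hν hw φ a) ?_ hG
    filter_upwards [((RCLike.continuous_re.tendsto _).comp (hLim φ)).eventually_lt_const ha]
      with i hi
    refine ⟨?_, y i, ?_, le_of_lt hi⟩
    · filter_upwards [hGg i] with ω hω
      rw [hω]; exact hg1 i ω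
    · filter_upwards [hGg i, hy i] with ω h1 h2
      rw [h1, h2]
  obtain ⟨-, z, hz, -⟩ := key 0 (RCLike.re (L 0) + 1) (lt_add_one _)
  refine ⟨z, fun φ => ?_⟩
  have hre : ∀ ψ : StrongDual 𝕜 Y, RCLike.re (ψ z) ≤ RCLike.re (L ψ) := by
    intro ψ
    refine le_of_forall_gt_imp_ge_of_dense fun a ha => ?_
    obtain ⟨-, z', hz', hle⟩ := key ψ a ha
    have : z' = z := Y.coe_ext (by filter_upwards [hz, hz'] with ω h1 h2; rw [h1, h2])
    rwa [this] at hle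
  have heq : φ z = L φ := by
    have h1 := hre ((starRingEnd 𝕜) (φ z - L φ) • φ)
    rw [map_smul, smul_apply, smul_eq_mul, smul_eq_mul, ← sub_nonpos, ← map_sub, ← mul_sub,
      RCLike.conj_mul, ← RCLike.ofReal_pow, RCLike.ofReal_re] at h1
    rw [← sub_eq_zero, ← norm_eq_zero]
    exact pow_eq_zero_iff two_ne_zero |>.1 (le_antisymm h1 (sq_nonneg _))
  rw [heq]
  exact hLim φ

end IdealSpace

namespace KotheSpace

variable {𝕜 : Type*} [RCLike 𝕜] {Ω : Type*} [MeasurableSpace Ω] {μ : Measure Ω}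

theorem exists_forall_ae_norm_le (X : KotheSpace 𝕜 μ) {v : ℕ → X}
    (hv : Summable fun n => ‖v n‖) :
    ∃ z : X, ∀ n, ∀ᵐ ω ∂μ, ‖(v n : Ω →ₘ[μ] 𝕜) ω‖ ≤ ‖(z : Ω →ₘ[μ] 𝕜) ω‖ := by
  set u : ℕ → X := fun n => X.abs (v n) with hudef
  have hu : ∀ n, X.abs (u n) = u n := fun n => X.abs_abs _
  have hsum : Summable u := Summable.of_norm (by simpa only [hudef, X.norm_abs] using hv)
  refine ⟨∑' k, u k, fun n => ?_⟩
  have hle : X.abs (∑' k, u k - u n) = ∑' k, u k - u n := by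
    have hcl : IsClosed {g : X | X.abs g = g} := isClosed_eq X.continuous_abs continuous_id
    refine hcl.mem_of_tendsto (hsum.hasSum.sub_const (u n)) ?_
    filter_upwards [eventually_ge_atTop {n}] with s hs
    rw [← Finset.add_sum_erase s u (hs (Finset.mem_singleton_self n)), add_sub_cancel_left]
    exact X.abs_sum_of_abs u hu _
  have h3 := X.coeFn_add' (∑' k, u k - u n) (u n)
  rw [sub_add_cancel] at h3
  have h1 := X.coeFn_abs (∑' k, u k - u n)
  rw [hle] at h1
  filter_upwards [h1, X.coeFn_abs (v n), h3] with ω h1 h2 h3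
  rw [h3, h1, h2, ← RCLike.ofReal_add, RCLike.norm_ofReal]
  exact (le_add_of_nonneg_left (norm_nonneg _)).trans (le_abs_self _)

/-- A Köthe space over a σ-finite measure contains a function without zeros. -/
theorem exists_ae_ne_zero [SigmaFinite μ] (X : KotheSpace 𝕜 μ) :
    ∃ h : X, ∀ᵐ ω ∂μ, (h : Ω →ₘ[μ] 𝕜) ω ≠ 0 := by
  let e : ℕ → X := fun n => ⟨_root_.charFun 𝕜 μ (spanningSets μ n) (measurableSet_spanningSets μ n),
    X.char_mem _ (measurableSet_spanningSets μ n) (measure_spanningSets_lt_top μ n)⟩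
  have he : ∀ n, ∀ᵐ ω ∂μ,
      (e n : Ω →ₘ[μ] 𝕜) ω = (spanningSets μ n).indicator (fun _ => (1 : 𝕜)) ω :=
    fun n => AEEqFun.coeFn_mk _ _
  have hpos : ∀ n, 0 < 2 ^ n * (‖e n‖ + 1) := fun n => by positivity
  set c : ℕ → 𝕜 := fun n => (((2 ^ n * (‖e n‖ + 1))⁻¹ : ℝ) : 𝕜) with hc
  have hc0 : ∀ n, c n ≠ 0 := fun n => RCLike.ofReal_ne_zero.2 (inv_pos.2 (hpos n)).ne'
  obtain ⟨z, hz⟩ := X.exists_forall_ae_norm_le (v := fun n => c n • e n) (by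
    refine Summable.of_nonneg_of_le (fun _ => norm_nonneg _) (fun n => ?_) summable_geometric_two
    rw [norm_smul, hc, RCLike.norm_ofReal, abs_of_pos (inv_pos.2 (hpos n)),
      inv_mul_le_iff₀ (hpos n), mul_comm, ← mul_assoc, ← mul_pow]
    norm_num)
  refine ⟨z, ?_⟩
  filter_upwards [ae_all_iff.2 hz, ae_all_iff.2 he,
    ae_all_iff.2 fun n => X.coeFn_smul' (c n) (e n)] with ω h1 h2 h3 h0
  have hω : ω ∈ ⋃ n, spanningSets μ n := by rw [iUnion_spanningSets]; trivial
  obtain ⟨n, hn⟩ := Set.mem_iUnion.1 hω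
  have := h1 n
  rw [h3, h2, Set.indicator_of_mem hn, mul_one, h0, norm_zero] at this
  exact hc0 n (norm_le_zero_iff.1 this)

variable [SigmaFinite μ] (X Y : KotheSpace 𝕜 μ) (l : multipliers X Y)

theorem hasAbsContNorm_mulOp {l : multipliers X Y} (hl : (multipliers X Y).HasAbsContNorm l)
    (f : X) : Y.HasAbsContNorm (mulOp X Y l f) := by
  refine IdealSpace.hasAbsContNorm_of_tendsto_proj fun σ hσ ha h0 => ?_
  refine squeeze_zero (fun _ => norm_nonneg _) (fun n => ?_)
    (by simpa using (hl.tendsto_proj hσ ha h0).mul_const ‖f‖)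
  rw [proj_mulOp X Y l (hσ n), ← mulOp_proj X Y l (hσ n), ← norm_mulOp]
  exact ContinuousLinearMap.le_opNorm _ _

/-- A multiplier with absolutely continuous norm is uniformly small on the parts of functions of
the unit ball that exceed a large multiple of a fixed function without zeros. -/
theorem exists_norm_mulOp_proj_le {l : multipliers X Y} (hl : (multipliers X Y).HasAbsContNorm l)
    {h : X} (hh : ∀ᵐ ω ∂μ, (h : Ω →ₘ[μ] 𝕜) ω ≠ 0) {ε : ℝ} (hε : 0 < ε) :
    ∃ c : ℝ, 0 < c ∧ ∀ f : X, ‖f‖ ≤ 1 → ‖mulOp X Y l (X.proj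
      {ω | ‖(f : Ω →ₘ[μ] 𝕜) ω‖ ≤ c * ‖(h : Ω →ₘ[μ] 𝕜) ω‖}ᶜ f)‖ ≤ ε := by
  by_contra! hcon
  choose f hf1 hf2 using fun k : ℕ => hcon (4 ^ k) (by positivity)
  obtain ⟨z, hz⟩ := X.exists_forall_ae_norm_le
    (v := fun k => ((((1 / 2 : ℝ) ^ k : ℝ)) : 𝕜) • f k) (by
      refine Summable.of_nonneg_of_le (fun _ => norm_nonneg _) (fun n => ?_) summable_geometric_two
      rw [norm_smul, RCLike.norm_ofReal, abs_of_pos (by positivity)]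
      exact mul_le_of_le_one_right (by positivity) (hf1 n))
  have hm : ∀ f : X, Measurable fun ω => ‖(f : Ω →ₘ[μ] 𝕜) ω‖ := fun f =>
    (AEEqFun.measurable _).norm
  set σ : ℕ → Set Ω := fun k => {ω | 2 ^ k * ‖(h : Ω →ₘ[μ] 𝕜) ω‖ ≤ ‖(z : Ω →ₘ[μ] 𝕜) ω‖} with hσd
  have hσ : ∀ k, MeasurableSet (σ k) := fun k =>
    measurableSet_le ((hm h).const_mul _) (hm z)
  have ha : Antitone σ := by
    intro m n hmn ω hω
    have hω' : 2 ^ n * ‖(h : Ω →ₘ[μ] 𝕜) ω‖ ≤ ‖(z : Ω →ₘ[μ] 𝕜) ω‖ := hω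
    refine le_trans (b := 2 ^ n * ‖(h : Ω →ₘ[μ] 𝕜) ω‖) ?_ hω'
    gcongr
    norm_num
  have h0 : μ (⋂ n, σ n) = 0 := by
    rw [measure_eq_zero_iff_ae_notMem]
    filter_upwards [hh] with ω h1 hω
    have hpos : 0 < ‖(h : Ω →ₘ[μ] 𝕜) ω‖ := norm_pos_iff.2 h1
    obtain ⟨n, hn⟩ := pow_unbounded_of_one_lt (‖(z : Ω →ₘ[μ] 𝕜) ω‖ / ‖(h : Ω →ₘ[μ] 𝕜) ω‖)
      (one_lt_two : (1 : ℝ) < 2)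
    rw [div_lt_iff₀ hpos] at hn
    exact hn.not_ge (Set.mem_iInter.1 hω n)
  obtain ⟨k, hk⟩ := ((hl.tendsto_proj hσ ha h0).eventually_lt_const hε).exists
  refine hk.not_ge ((hf2 k).le.trans ?_)
  set τ : Set Ω := {ω | ‖(f k : Ω →ₘ[μ] 𝕜) ω‖ ≤ 4 ^ k * ‖(h : Ω →ₘ[μ] 𝕜) ω‖}ᶜ with hτd
  have hτ : MeasurableSet τ := (measurableSet_le (hm _) ((hm h).const_mul _)).compl
  calc ‖mulOp X Y l (X.proj τ (f k))‖ ≤ ‖mulOp X Y l (X.proj (σ k) (f k))‖ := by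
        apply Y.norm_le_of_ae_le
        filter_upwards [coeFn_mulOp X Y l (X.proj τ (f k)),
          coeFn_mulOp X Y l (X.proj (σ k) (f k)), X.coeFn_proj hτ (f k),
          X.coeFn_proj (hσ k) (f k), hz k,
          X.coeFn_smul' ((((1 / 2 : ℝ) ^ k : ℝ)) : 𝕜) (f k)] with ω h1 h2 h3 h4 h5 h6
        rw [h1, h2, h3, h4]
        by_cases hω : ω ∈ τ
        · have hω' : ω ∈ σ k := by
            have h7 : 4 ^ k * ‖(h : Ω →ₘ[μ] 𝕜) ω‖ < ‖(f k : Ω →ₘ[μ] 𝕜) ω‖ := not_le.1 hω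
            change 2 ^ k * ‖(h : Ω →ₘ[μ] 𝕜) ω‖ ≤ ‖(z : Ω →ₘ[μ] 𝕜) ω‖
            refine le_trans ?_ h5
            rw [h6, norm_mul, RCLike.norm_ofReal, abs_of_pos (by positivity)]
            calc (2 : ℝ) ^ k * ‖(h : Ω →ₘ[μ] 𝕜) ω‖
                = (1 / 2) ^ k * (4 ^ k * ‖(h : Ω →ₘ[μ] 𝕜) ω‖) := by
                  rw [← mul_assoc, ← mul_pow]; norm_num
              _ ≤ _ := by gcongr
          rw [Set.indicator_of_mem hω, Set.indicator_of_mem hω']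
        · rw [Set.indicator_of_notMem hω, mul_zero, norm_zero]
          exact norm_nonneg _
    _ = ‖mulOp X Y ((multipliers X Y).proj (σ k) l) (f k)‖ := by rw [mulOp_proj X Y l (hσ k)]
    _ ≤ ‖(multipliers X Y).proj (σ k) l‖ := ContinuousLinearMap.unit_le_opNorm _ _ (hf1 k)

theorem exists_tendsto_dual_mulOp {l : multipliers X Y} (hl : (multipliers X Y).HasAbsContNorm l)
    {ι : Type*} (𝒰 : Ultrafilter ι) {f : ι → X} (hf : ∀ i, ‖f i‖ ≤ 1) :
    ∃ z : Y, ∀ φ : StrongDual 𝕜 Y,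
      Tendsto (fun i => φ (mulOp X Y l (f i))) (𝒰 : Filter ι) (𝓝 (φ z)) := by
  obtain ⟨h, hh⟩ := X.exists_ae_ne_zero
  refine exists_tendsto_dual_of_approx 𝒰 (R := ‖mulOp X Y l‖)
    (Eventually.of_forall fun i => ContinuousLinearMap.unit_le_opNorm _ _ (hf i)) fun ε hε => ?_
  obtain ⟨c, hc, hcf⟩ := exists_norm_mulOp_proj_le X Y hl hh hε
  set E : ι → Set Ω := fun i =>
    {ω | ‖(f i : Ω →ₘ[μ] 𝕜) ω‖ ≤ c * ‖(h : Ω →ₘ[μ] 𝕜) ω‖} with hEd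
  have hE : ∀ i, MeasurableSet (E i) := fun i =>
    measurableSet_le (AEEqFun.measurable _).norm ((AEEqFun.measurable _).norm.const_mul _)
  obtain ⟨z, hz⟩ := (hasAbsContNorm_mulOp X Y hl ((c : 𝕜) • h)).exists_tendsto_dual 𝒰
    (g := fun i => (E i).indicator
      fun ω => (f i : Ω →ₘ[μ] 𝕜) ω / ((c : 𝕜) * (h : Ω →ₘ[μ] 𝕜) ω))
    (fun i => ((AEEqFun.measurable _).div ((AEEqFun.measurable _).const_mul _)).indicator (hE i))
    (fun i ω => by
      by_cases hω : ω ∈ E i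
      · rw [Set.indicator_of_mem hω, norm_div, norm_mul, RCLike.norm_ofReal, abs_of_pos hc]
        exact div_le_one_of_le₀ hω (by positivity)
      · rw [Set.indicator_of_notMem hω, norm_zero]
        exact zero_le_one)
    (y := fun i => mulOp X Y l (X.proj (E i) (f i))) (fun i => by
      filter_upwards [hh, coeFn_mulOp X Y l (X.proj (E i) (f i)), X.coeFn_proj (hE i) (f i),
        coeFn_mulOp X Y l ((c : 𝕜) • h), X.coeFn_smul' (c : 𝕜) h] with ω h0 h1 h2 h3 h4
      rw [h1, h2, h3, h4]
      by_cases hω : ω ∈ E i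
      · have hne : (c : 𝕜) * (h : Ω →ₘ[μ] 𝕜) ω ≠ 0 :=
          mul_ne_zero (RCLike.ofReal_ne_zero.2 hc.ne') h0
        rw [Set.indicator_of_mem hω, Set.indicator_of_mem hω, mul_assoc, mul_div_cancel₀ _ hne]
      · rw [Set.indicator_of_notMem hω, Set.indicator_of_notMem hω, mul_zero, mul_zero])
  refine ⟨_, z, Eventually.of_forall fun i => ?_, hz⟩
  rw [← map_sub, ← X.proj_compl (hE i)]
  exact hcf _ (hf i)

theorem mulOp_mem_weaklyCompactOps (hl : l ∈ (multipliers X Y).ocPart) :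
    mulOp X Y l ∈ weaklyCompactOps X Y := by
  intro S hS
  obtain ⟨R, hR0, hR⟩ := hS.exists_pos_norm_le
  refine isCompact_closure_toWeakSpace_image ((mulOp X Y l).lipschitz.isBounded_image hS)
    fun 𝒰 h𝒰 => ?_
  have hinv : ∀ y : Y, ∃ f : X, ‖f‖ ≤ 1 ∧
      (y ∈ mulOp X Y l '' S → (R : 𝕜) • mulOp X Y l f = y) := by
    intro y
    by_cases hy : y ∈ mulOp X Y l '' S
    · obtain ⟨f, hf, rfl⟩ := hy
      refine ⟨((R⁻¹ : ℝ) : 𝕜) • f, ?_, fun _ => ?_⟩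
      · rw [norm_smul, RCLike.norm_ofReal, abs_of_pos (inv_pos.2 hR0), inv_mul_le_iff₀ hR0, mul_one]
        exact hR f hf
      · rw [map_smul, smul_smul, ← RCLike.ofReal_mul, mul_inv_cancel₀ hR0.ne', RCLike.ofReal_one,
          one_smul]
    · exact ⟨0, by simp, fun h => absurd h hy⟩
  choose f hf1 hf2 using hinv
  obtain ⟨z, hz⟩ := exists_tendsto_dual_mulOp X Y (IdealSpace.mem_ocPart_iff.1 hl) 𝒰 hf1
  refine ⟨(R : 𝕜) • z, fun φ => ?_⟩
  rw [map_smul]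
  refine ((hz φ).const_smul (R : 𝕜)).congr' ?_
  filter_upwards [h𝒰] with y hy
  rw [← map_smul, hf2 y hy]

theorem infDist_weaklyCompactOps_eq (hY : Y.HasFatou) (hDH : Y.IsOneDH)
    (h : ∀ f : multipliers X Y, (f : Ω →ₘ[μ] 𝕜) ∈ simpleFunctions 𝕜 μ →
      (multipliers X Y).HasAbsContNorm f) :
    Metric.infDist (mulOp X Y l) (weaklyCompactOps X Y) =
      Metric.infDist l (multipliers X Y).ocPart := by
  refine le_antisymm (infDist_mulOp_le X Y l _ fun l' hl' => mulOp_mem_weaklyCompactOps X Y l' hl')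
    ((Metric.le_infDist ?_).2 fun W hW =>
      infDist_ocPart_le_dist_of_mem_weaklyCompactOps X Y l hY hDH h hW)
  exact ⟨_, mulOp_mem_weaklyCompactOps X Y 0 (multipliers X Y).zero_mem_ocPart⟩

end KotheSpace

theorem mainTheorem6 {𝕜 : Type*} [RCLike 𝕜] {Ω : Type*} [MeasurableSpace Ω] (μ : Measure Ω)
    [μ.IsComplete] [SigmaFinite μ] (X Y : KotheSpace 𝕜 μ) (hX : X.HasFatou) (hY : Y.HasFatou) :
    (IsPurelyAtomic μ → (X.IsReflexive ∨ Y.IsOrderContinuous) →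
      ∀ lam : KotheSpace.multipliers X Y,
        Metric.infDist (KotheSpace.mulCLM X Y lam) (KotheSpace.compactOps X Y) =
          Metric.infDist lam (KotheSpace.multipliers X Y).ocPart) ∧
    (IsNonAtomic μ → Y.IsOneDH →
      (∀ f : KotheSpace.multipliers X Y, (f : Ω →ₘ[μ] 𝕜) ∈ simpleFunctions 𝕜 μ →
        (KotheSpace.multipliers X Y).HasAbsContNorm f) →
      ∀ lam : KotheSpace.multipliers X Y,
        Metric.infDist (KotheSpace.mulCLM X Y lam) (KotheSpace.weaklyCompactOps X Y) =
          Metric.infDist lam (KotheSpace.multipliers X Y).ocPart) :=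
  ⟨fun hμ h lam => KotheSpace.infDist_compactOps_eq X Y lam hμ h,
    fun _ hDH h lam => KotheSpace.infDist_weaklyCompactOps_eq X Y lam hY hDH h⟩
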